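/- **Setting.** Write $T_xf(t)=f(t-x)$, $M_\omega f(t)=e^{2\pi i\omega\cdot t}f(t)$, $\widehat f(\omega)=\int_{\mathbb R^m}f(t)e^{-2\pi i t\cdot\omega}\,dt$ and $B(x,R)=x+R[0,1]^m$. Let $\Gamma\subset\mathbb R^m\times\mathbb R$ be a lattice such that both coordinate projections $p_1:\mathbb R^m\times\mathbb R\to\mathbb R^m$ and $p_2:\mathbb R^m\times\mathbb R\to\mathbb R$ are injective on $\Gamma$ and $p_1(\Gamma)$, $p_2(\Gamma)$ are dense. Let $\Gamma^*=\{\eta\in\mathbb R^m\times\mathbb R:\gamma\cdot\eta\in\mathbb Z\ \text{for all}\ \gamma\in\Gamma\}$ be the dual lattice, and let $p_1^*,p_2^*$ be the coordinate projections on $\Gamma^*$. Let $\Omega\subset\mathbb R$ be a nonempty compact interval that is the closure of its interior, symmetric around the origin, with $\partial\Omega\cap p_2(\Gamma)=\emptyset$, and let $$\Lambda(\Omega)=\{p_1(\gamma):\gamma\in\Gamma,\ p_2(\gamma)\in\Omega\}$$ be the corresponding simple generic model set, with density $D(\Lambda(\Omega))=\lim_{R\to\infty}\#(\Lambda(\Omega)\cap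 B(x,R))/R^m$ (the limit exists and does not depend on $x\in\mathbb R^m$). Let $0<\varepsilon<1$, let $|\cdot|$ be Lebesgue measure on $\mathbb R$, $\operatorname{sinc}x=\frac{\sin\pi x}{\pi x}$ (with $\operatorname{sinc}0=1$), $\Omega_n=(1-\varepsilon^n)\Omega$ and $\widehat\psi_n(t)=\prod_{s=0}^\infty\operatorname{sinc}(t\,|\varepsilon^{ns}\Omega_n|)$. Let $\Psi$ be the uniform limit of $(\widehat\psi_n)_n$ (which exists), and let $\Phi=|\Omega|\,(\Psi*\Psi)$, where the convolution integral converges absolutely at every point. Let $\Delta\subset\mathbb R^m$ be relatively dense (for some $r>0$, every cube $B(t,r)$ meets $\Delta$) and uniformly discrete (distinct points of $\Delta$ have distance at least some $r'>0$). Let $W(L^2,\ell^1)$ be the space of $f\in L^2(\mathbb R^m)$ with $\sum_{k\in\mathbb Z^m}\|f\,\mathbb 1_{k+[0,1]^m}\|_2<\infty$, let $g_1,\dots,g_L,h_1,\dots,h_L\in W(L^2,\ell^1)$, and let $$\mathcal G(g,\Lambda(\Omega),\Delta)=\{T_\lambda M_\beta g_l:\ l=1,\dots,L,\ \lambda\in\Lambda(\Omega),\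 \beta\in\Delta\},$$ and similarly $\mathcal G(h,\Lambda(\Omega),\Delta)$. A family $(e_i)$ in $L^2(\mathbb R^m)$ is a Bessel sequence if for some constant $B>0$ one has $\sum_i|\langle f,e_i\rangle|^2\le B\|f\|_2^2$ for all $f\in L^2(\mathbb R^m)$. The system $\mathcal G(h,\Lambda(\Omega),\Delta)$ is dual to $\mathcal G(g,\Lambda(\Omega),\Delta)$ if $$f=\sum_{l=1}^L\sum_{\beta\in\Delta}\sum_{\lambda\in\Lambda(\Omega)}\langle f,T_\lambda M_\beta g_l\rangle\,T_\lambda M_\beta h_l\qquad\text{for all } f\in L^2(\mathbb R^m),$$ with unconditional convergence in $L^2(\mathbb R^m)$. **Statement.** Assume that $\mathcal G(g,\Lambda(\Omega),\Delta)$ and $\mathcal G(h,\Lambda(\Omega),\Delta)$ are Bessel sequences for $L^2(\mathbb R^m)$. Then $\mathcal G(h,\Lambda(\Omega),\Delta)$ is dual to $\mathcal G(g,\Lambda(\Omega),\Delta)$ if and only if, for every $\eta\in\Gamma^*$, $$D(\Lambda(\Omega))\,\Phi(-p_2^*(\eta))\sum_{l=1}^L\sum_{\beta\in\Delta}\overline{\widehat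 g_l(t-\beta)}\,\widehat h_l(t-\beta-p_1^*(\eta))=\delta_{\eta,0}\qquad\text{for a.e. } t\in\mathbb R^m,$$ where $\delta_{\eta,0}$ is $1$ for $\eta=0$ and $0$ otherwise. Here the series over $\Delta$ converges absolutely for a.e. $t$, for each $l$ and each $\eta\in\Gamma^*$. -/

import Mathlib

open MeasureTheory Filter Topology
open scoped FourierTransform Pointwise ENNReal NNReal ComplexConjugate InnerProductSpace

noncomputable section

namespace ModelSetGabor

/-- Euclidean space `ℝᵐ`. -/
abbrev Rm (m : ℕ) : Type := EuclideanSpace ℝ (Fin m)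

/-- Complex valued `L²(ℝᵐ)`. -/
abbrev L2 (m : ℕ) : Type := Lp ℂ 2 (volume : Measure (Rm m))

/-- The cube `B(x, R) = R [0,1]ᵐ + x`. -/
def cube {m : ℕ} (x : Rm m) (R : ℝ) : Set (Rm m) :=
  {y | ∀ i, x i ≤ y i ∧ y i ≤ x i + R}

/-! ### Model sets -/

/-- The dual lattice `Γ*` in `ℝᵐ × ℝ`, for the dot product of the orthogonal sum: all `η` with
`γ · η = p₁(γ) · p₁(η) + p₂(γ) p₂(η) ∈ ℤ` for every `γ ∈ Γ`. -/
def dualLattice {m : ℕ} (Γ : Submodule ℤ (Rm m × ℝ)) : Set (Rm m × ℝ) :=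
  {η | ∀ γ ∈ Γ, ∃ k : ℤ, ⟪γ.1, η.1⟫_ℝ + γ.2 * η.2 = k}

/-- Both coordinate projections are injective on `Γ` and map it onto a dense subgroup. -/
structure ProjectionsInjectiveDense {m : ℕ} (Γ : Submodule ℤ (Rm m × ℝ)) : Prop where
  injOn_fst : Set.InjOn Prod.fst (Γ : Set (Rm m × ℝ))
  dense_fst : Dense (Prod.fst '' (Γ : Set (Rm m × ℝ)))
  injOn_snd : Set.InjOn Prod.snd (Γ : Set (Rm m × ℝ))
  dense_snd : Dense (Prod.snd '' (Γ : Set (Rm m × ℝ)))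

/-- A window of a simple model set: a nonempty compact interval of the line which is the closure
of its interior. (The boundary of an interval is automatically a null set.) -/
structure IsSimpleWindow (Ω : Set ℝ) : Prop where
  nonempty : Ω.Nonempty
  isCompact : IsCompact Ω
  ordConnected : Ω.OrdConnected
  closure_interior : closure (interior Ω) = Ω

/-- The model set `Λ(Ω) = {p₁(γ) : γ ∈ Γ, p₂(γ) ∈ Ω}`. -/
def modelSet {m : ℕ} (Γ : Submodule ℤ (Rm m × ℝ)) (Ω : Set ℝ) : Set (Rm m) :=
  Prod.fst '' {γ : Rm m × ℝ | γ ∈ Γ ∧ γ.2 ∈ Ω}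

/-- The model set is generic: the boundary of the window does not meet `p₂(Γ)`. -/
def IsGeneric {m : ℕ} (Γ : Submodule ℤ (Rm m × ℝ)) (Ω : Set ℝ) : Prop :=
  ∀ γ ∈ Γ, γ.2 ∉ frontier Ω

/-- `Λ` has density `D`: for every `x`, `#(Λ ∩ B(x, R)) / Rᵐ → D` as `R → ∞`. -/
def HasDensity {m : ℕ} (Λ : Set (Rm m)) (D : ℝ) : Prop :=
  ∀ x : Rm m, Tendsto (fun R : ℝ => ((Λ ∩ cube x R).ncard : ℝ) / R ^ m) atTop (𝓝 D)

/-- The density `D(Λ) = lim_{R → ∞} #(Λ ∩ B(0, R)) / Rᵐ`. -/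
def density {m : ℕ} (Λ : Set (Rm m)) : ℝ :=
  limUnder atTop (fun R : ℝ => ((Λ ∩ cube 0 R).ncard : ℝ) / R ^ m)

def IsRelativelyDense {m : ℕ} (Δ : Set (Rm m)) : Prop :=
  ∃ r : ℝ, 0 < r ∧ ∀ t, (Δ ∩ cube t r).Nonempty

def IsUniformlyDiscrete {m : ℕ} (Δ : Set (Rm m)) : Prop :=
  ∃ r : ℝ, 0 < r ∧ ∀ x ∈ Δ, ∀ y ∈ Δ, x ≠ y → r ≤ dist x y

/-! ### The function `Φ` -/

/-- With `Ωₙ = (1 - εⁿ) Ω`, the function `t ↦ ∏_{s ≥ 0} sinc (t |ε^{ns} Ωₙ|)`, where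
`sinc x = sin (π x) / (π x)` (so `sinc x = Real.sinc (π x)`). -/
def psiHat (ε : ℝ) (Ω : Set ℝ) (n : ℕ) (t : ℝ) : ℝ :=
  ∏' s : ℕ, Real.sinc (Real.pi * (t * volume.real (ε ^ (n * s) • ((1 - ε ^ n) • Ω))))

/-- The limit `Ψ` of the functions `psiHat ε Ω n` as `n → ∞`. -/
def Psi (ε : ℝ) (Ω : Set ℝ) (t : ℝ) : ℝ :=
  limUnder atTop (fun n : ℕ => psiHat ε Ω n t)

/-- `Φ = |Ω| (Ψ * Ψ)`, with `*` the convolution on the line. -/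
def Phi (ε : ℝ) (Ω : Set ℝ) (t : ℝ) : ℝ :=
  volume.real Ω * ∫ x : ℝ, Psi ε Ω x * Psi ε Ω (t - x)

/-! ### Wiener amalgam space, Gabor systems, Bessel sequences, duals -/

/-- Membership in the Wiener amalgam space `W(L², ℓ¹)`: the `L²` norms over the unit cubes
`[0,1]ᵐ + k`, `k ∈ ℤᵐ`, are summable. -/
def MemWiener {m : ℕ} (f : L2 m) : Prop :=
  ∑' k : Fin m → ℤ,
    eLpNorm ((cube (WithLp.toLp 2 fun i => (k i : ℝ)) 1).indicator (f : Rm m → ℂ)) 2 volume < ∞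

/-- The translation `T_x f (t) = f (t - x)`. -/
def translate {m : ℕ} (x : Rm m) (f : Rm m → ℂ) (t : Rm m) : ℂ := f (t - x)

/-- The modulation `M_ω f (t) = e^{2 π i ω · t} f (t)`. -/
def modulate {m : ℕ} (ω : Rm m) (f : Rm m → ℂ) (t : Rm m) : ℂ :=
  Complex.exp (2 * Real.pi * Complex.I * (⟪ω, t⟫_ℝ : ℝ)) * f t

theorem memLp_translate_modulate {m : ℕ} (x ω : Rm m) (f : L2 m) :
    MemLp (translate x (modulate ω f)) 2 (volume : Measure (Rm m)) := by
  have h : MemLp (modulate ω (f : Rm m → ℂ)) 2 (volume : Measure (Rm m)) := by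
    refine (Lp.memLp f).of_le ?_ (Eventually.of_forall fun t => ?_)
    · refine AEStronglyMeasurable.mul ?_ (Lp.memLp f).1
      exact Continuous.aestronglyMeasurable (by fun_prop)
    · have : (2 * Real.pi * Complex.I * (⟪ω, t⟫_ℝ : ℝ) : ℂ)
          = ((2 * Real.pi * ⟪ω, t⟫_ℝ : ℝ) : ℂ) * Complex.I := by push_cast; ring
      rw [modulate, norm_mul, this, Complex.norm_exp_ofReal_mul_I, one_mul]
  exact h.comp_measurePreserving (measurePreserving_sub_right volume x)

/-- The Gabor system `𝒢(g, Λ, Δ) = {T_λ M_β g_l : l, β ∈ Δ, λ ∈ Λ}`, as an indexed family in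
`L²(ℝᵐ)`. -/
def gaborSystem {m L : ℕ} (g : Fin L → L2 m) (Λ Δ : Set (Rm m)) :
    (Fin L × Δ) × Λ → L2 m :=
  fun i => (memLp_translate_modulate (i.2 : Rm m) (i.1.2 : Rm m) (g i.1.1)).toLp

/-- `e` is a Bessel sequence: `∑ᵢ |⟨f, eᵢ⟩|² ≤ B ‖f‖²` for all `f`, with a finite constant `B`. -/
def IsBessel {ι H : Type*} [NormedAddCommGroup H] [InnerProductSpace ℂ H] (e : ι → H) : Prop :=
  ∃ B : ℝ, 0 < B ∧ ∀ f : H, Summable (fun i => ‖⟪e i, f⟫_ℂ‖ ^ 2) ∧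
    ∑' i, ‖⟪e i, f⟫_ℂ‖ ^ 2 ≤ B * ‖f‖ ^ 2

/-- `e'` is a dual of `e`: the mixed frame operator `f ↦ ∑ᵢ ⟨f, eᵢ⟩ e'ᵢ` is the identity.
(Mathlib's inner product is linear in the second variable, so `⟨f, eᵢ⟩` is `⟪e i, f⟫_ℂ`.) -/
def IsDualSystem {ι H : Type*} [NormedAddCommGroup H] [InnerProductSpace ℂ H]
    (e' e : ι → H) : Prop :=
  ∀ f : H, HasSum (fun i => ⟪e i, f⟫_ℂ • e' i) f

open scoped Classical in
/-- The Kronecker delta `δ_{η,0}`. -/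
def delta {m : ℕ} (η : Rm m × ℝ) : ℂ := if η = 0 then 1 else 0

end ModelSetGabor

end

open ModelSetGabor

/-!
The mixed frame form `x ↦ ∑ ⟨T₋ₓ f₁, T_λ u⟩ ⟨T_λ v, T₋ₓ f₂⟩` over the model set is the restriction
to the slice `ℝᵐ × {0}` of a function on the torus `(ℝᵐ × ℝ) / Γ`, namely the periodization of the
sum over the modulated generators alone, tensored with the indicator function of `Ω`. The slice
winds densely around the torus and genericity makes the periodization continuous across it, so
duality says that the periodization is almost everywhere equal to `⟨f₂, f₁⟩`, that is, that its
Fourier coefficients are those of a constant. These are indexed by `Γ*` and split into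
`𝓕 1_Ω (p₂* η) / covol Γ` and the Fourier transform at `p₁* η` of the sum over the generators,
which by Plancherel is the integral of `φ₁ · conj φ₂(· - p₁* η)`, with `φᵢ` the Fourier transform
of `fᵢ`, against the series over `Δ` in the theorem; since `φ₁` and `φ₂` are arbitrary, that
series can be isolated pointwise. Finally `D = |Ω| / covol Γ`; the first factor of `psiHat ε Ω n`
tends to `sinc (t |Ω|)` and the product of the others to `1`, so `Ψ(t) = sinc (t |Ω|)`, which
convolves with itself to `Ψ / |Ω|`, so that `D Φ` is `𝓕 1_Ω / covol Γ` up to a phase, trivial for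
symmetric `Ω`.

The Bessel condition over `Ω` extends to every bounded window, because `p₂(Γ)` is dense and
finitely many translates of the interior of `Ω` cover such a window. This supplies all the
absolute convergence that is needed.
-/

namespace ModelSetGabor

section RealSchwartz

variable {V : Type*} [NormedAddCommGroup V] [NormedSpace ℝ V] {g : V → ℝ}

/-- A smooth compactly supported real function as a complex Schwartz function. -/
noncomputable def realSchwartz (hg : ContDiff ℝ (⊤ : ℕ∞) g) (hgs : HasCompactSupport g) :
    SchwartzMap V ℂ :=
  HasCompactSupport.toSchwartzMap (f := fun x => (g x : ℂ))
    (hgs.comp_left (g := fun t : ℝ => (t : ℂ)) Complex.ofReal_zero)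
    (Complex.ofRealCLM.contDiff.comp hg)

theorem realSchwartz_apply (hg : ContDiff ℝ (⊤ : ℕ∞) g)
    (hgs : HasCompactSupport g) (t : V) : realSchwartz hg hgs t = (g t : ℂ) := rfl

end RealSchwartz

section Plancherel

variable {V F : Type*} [NormedAddCommGroup V] [InnerProductSpace ℝ V] [FiniteDimensional ℝ V]
  [MeasurableSpace V] [BorelSpace V] [NormedAddCommGroup F]

section NormedSpace

variable [NormedSpace ℂ F]

theorem continuous_fourier_of_integrable {f : V → F} (hf : Integrable f) : Continuous (𝓕 f) :=
  VectorFourier.fourierIntegral_continuous Real.continuous_fourierChar continuous_inner hf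

theorem integral_fourier_smul_eq [CompleteSpace F] (φ : SchwartzMap V ℂ) {f : V → F}
    (hf : Integrable f) : ∫ x, 𝓕 φ x • f x = ∫ x, φ x • 𝓕 f x := by
  simpa using! VectorFourier.integral_fourierIntegral_smul_eq_flip (L := innerₗ V)
    (μ := (volume : Measure V)) (ν := volume) Real.continuous_fourierChar continuous_inner
    φ.integrable hf

end NormedSpace

variable [InnerProductSpace ℂ F] [CompleteSpace F] {f g : V → F}

theorem coeFn_fourier_toLp (hf : Integrable f) (hf2 : MemLp f 2) :
    ((𝓕 (hf2.toLp f) : Lp F 2 (volume : Measure V)) : V → F) =ᵐ[volume] 𝓕 f := by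
  -- Both sides define the same tempered distribution.
  refine ae_eq_of_integral_contDiff_smul_eq ((Lp.memLp _).locallyIntegrable (by norm_num))
    (continuous_fourier_of_integrable hf).locallyIntegrable fun g hg hgs => ?_
  let φ := realSchwartz hg hgs
  have hφ : ∀ u : V → F, ∫ x, g x • u x = ∫ x, φ x • u x := fun u => by
    simp only [φ, realSchwartz_apply, Complex.coe_smul]
  have hdistr : ∫ x, 𝓕 φ x • hf2.toLp f x
      = ∫ x, φ x • (𝓕 (hf2.toLp f) : Lp F 2 (volume : Measure V)) x := by
    simpa [TemperedDistribution.fourier_apply, Lp.toTemperedDistribution_apply] using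
      congrArg (fun T => T φ) (Lp.fourier_toTemperedDistribution_eq (hf2.toLp f))
  rw [hφ, hφ, ← hdistr, ← integral_fourier_smul_eq φ hf]
  refine integral_congr_ae ?_
  filter_upwards [hf2.coeFn_toLp] with x hx
  rw [hx]

theorem memLp_fourier (hf : Integrable f) (hf2 : MemLp f 2) : MemLp (𝓕 f) 2 :=
  (memLp_congr_ae (coeFn_fourier_toLp hf hf2)).1 (Lp.memLp _)

theorem eLpNorm_fourier (hf : Integrable f) (hf2 : MemLp f 2) :
    eLpNorm (𝓕 f) 2 volume = eLpNorm f 2 volume := by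
  rw [← eLpNorm_congr_ae (coeFn_fourier_toLp hf hf2), ← eLpNorm_congr_ae hf2.coeFn_toLp,
    ← Lp.enorm_def, ← Lp.enorm_def, ← ofReal_norm, ← ofReal_norm, Lp.norm_fourier_eq]

theorem integral_inner_fourier (hf : Integrable f) (hf2 : MemLp f 2) (hg : Integrable g)
    (hg2 : MemLp g 2) : ∫ x, ⟪𝓕 f x, 𝓕 g x⟫_ℂ = ∫ x, ⟪f x, g x⟫_ℂ :=
  calc ∫ x, ⟪𝓕 f x, 𝓕 g x⟫_ℂ = ⟪𝓕 (hf2.toLp f), 𝓕 (hg2.toLp g)⟫_ℂ := by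
        refine integral_congr_ae ?_
        filter_upwards [coeFn_fourier_toLp hf hf2, coeFn_fourier_toLp hg hg2] with x hfx hgx
        rw [hfx, hgx]
    _ = ⟪hf2.toLp f, hg2.toLp g⟫_ℂ := Lp.inner_fourier_eq _ _
    _ = ∫ x, ⟪f x, g x⟫_ℂ := by
        refine integral_congr_ae ?_
        filter_upwards [hf2.coeFn_toLp, hg2.coeFn_toLp] with x hfx hgx
        rw [hfx, hgx]

end Plancherel

section Sinc

theorem abs_sinc_sub_one_le (x : ℝ) : |Real.sinc x - 1| ≤ |x| := by
  rcases eq_or_ne x 0 with rfl | hx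
  · simp
  have habs : 0 < |x| := abs_pos.2 hx
  rcases le_or_gt 2 |x| with hlarge | hsmall
  · have := abs_le.1 (Real.abs_sinc_le_one x)
    exact (abs_le.2 ⟨by linarith, by linarith⟩).trans hlarge
  · have hdiv : Real.sinc x - 1 = (Real.sin x - x) / x := by
      rw [Real.sinc_of_ne_zero hx, sub_div, div_self hx]
    rw [hdiv, abs_div, div_le_iff₀ habs, abs_sub_comm]
    refine (Real.abs_sub_sin_le x).trans ?_
    nlinarith [mul_pos habs habs]

theorem abs_sinc_mul_abs_le_one (x : ℝ) : |Real.sinc x| * |x| ≤ 1 := by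
  rcases eq_or_ne x 0 with rfl | hx
  · simp
  · rw [Real.sinc_of_ne_zero hx, ← abs_mul, div_mul_cancel₀ _ hx]
    exact Real.abs_sin_le_one x

theorem abs_sinc_mul_sub_sinc_le (q x : ℝ) :
    |Real.sinc (q * x) - Real.sinc x| ≤ 2 * |1 - q| := by
  rcases eq_or_ne x 0 with rfl | hx
  · simp
  have hsin : ∀ y, Real.sinc y * y = Real.sin y := fun y => by
    rcases eq_or_ne y 0 with rfl | hy
    · simp
    · rw [Real.sinc_of_ne_zero hy, div_mul_cancel₀ _ hy]
  have hsplit : (Real.sinc (q * x) - Real.sinc x) * x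
      = Real.sinc (q * x) * ((1 - q) * x) + (Real.sin (q * x) - Real.sin x) := by
    rw [← hsin, ← hsin]
    ring
  have hlip : |Real.sin (q * x) - Real.sin x| ≤ |1 - q| * |x| := by
    refine (Real.abs_sin_sub_sin_le _ _).trans_eq ?_
    rw [← abs_mul, ← abs_neg]
    ring_nf
  refine le_of_mul_le_mul_right ?_ (abs_pos.2 hx)
  calc |Real.sinc (q * x) - Real.sinc x| * |x|
      ≤ |Real.sinc (q * x)| * (|1 - q| * |x|) + |Real.sin (q * x) - Real.sin x| := by
        rw [← abs_mul, hsplit, ← abs_mul, ← abs_mul]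
        exact abs_add_le _ _
    _ ≤ 1 * (|1 - q| * |x|) + |1 - q| * |x| := by
        gcongr
        exact Real.abs_sinc_le_one _
    _ = 2 * |1 - q| * |x| := by ring

theorem abs_prod_sub_one_le {ι : Type*} (s : Finset ι) {f : ι → ℝ} (hf : ∀ i, |f i| ≤ 1) :
    |∏ i ∈ s, f i - 1| ≤ ∑ i ∈ s, |f i - 1| := by
  classical
  induction s using Finset.induction_on with
  | empty => simp
  | insert a s ha ih =>
    rw [Finset.prod_insert ha, Finset.sum_insert ha]
    calc |f a * ∏ i ∈ s, f i - 1| = |f a * (∏ i ∈ s, f i - 1) + (f a - 1)| := by ring_nf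
      _ ≤ |f a| * |∏ i ∈ s, f i - 1| + |f a - 1| := by
        rw [← abs_mul]
        exact abs_add_le _ _
      _ ≤ 1 * |∏ i ∈ s, f i - 1| + |f a - 1| := by
        gcongr
        exact hf a
      _ ≤ |f a - 1| + ∑ i ∈ s, |f i - 1| := by linarith

theorem multipliable_of_summable_abs_sub_one {ι : Type*} {f : ι → ℝ}
    (hs : Summable fun i => |f i - 1|) : Multipliable f := by
  simpa using Real.multipliable_one_add_of_summable hs.of_abs

theorem abs_tprod_sub_one_le {ι : Type*} {f : ι → ℝ} (hf : ∀ i, |f i| ≤ 1)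
    (hs : Summable fun i => |f i - 1|) : |∏' i, f i - 1| ≤ ∑' i, |f i - 1| :=
  le_of_tendsto ((multipliable_of_summable_abs_sub_one hs).hasProd.sub_const 1).abs
    (Eventually.of_forall fun s =>
      (abs_prod_sub_one_le s hf).trans (hs.sum_le_tsum s fun _ _ => abs_nonneg _))

theorem abs_tprod_sinc_pow_mul_sub_sinc_le {q : ℝ} (hq : 0 ≤ q) (hq1 : q < 1) (y : ℝ) :
    |∏' s : ℕ, Real.sinc (q ^ s * y) - Real.sinc y| ≤ q / (1 - q) := by
  have hle : ∀ s : ℕ, |Real.sinc (q ^ (s + 1) * y) - 1| ≤ q ^ s * (q * |y|) := fun s => by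
    refine (abs_sinc_sub_one_le _).trans_eq ?_
    rw [abs_mul, abs_of_nonneg (pow_nonneg hq _), pow_succ, mul_assoc]
  have hgeom : Summable fun s : ℕ => q ^ s * (q * |y|) :=
    (summable_geometric_of_lt_one hq hq1).mul_right _
  have hsum : Summable fun s : ℕ => |Real.sinc (q ^ (s + 1) * y) - 1| :=
    hgeom.of_nonneg_of_le (fun _ => abs_nonneg _) hle
  have htail : |∏' s : ℕ, Real.sinc (q ^ (s + 1) * y) - 1| ≤ q / (1 - q) * |y| :=
    calc |∏' s : ℕ, Real.sinc (q ^ (s + 1) * y) - 1|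
        ≤ ∑' s : ℕ, |Real.sinc (q ^ (s + 1) * y) - 1| :=
          abs_tprod_sub_one_le (fun _ => Real.abs_sinc_le_one _) hsum
      _ ≤ ∑' s : ℕ, q ^ s * (q * |y|) := hsum.tsum_le_tsum hle hgeom
      _ = q / (1 - q) * |y| := by
          rw [tsum_mul_right, tsum_geometric_of_lt_one hq hq1]
          ring
  have hsplit : ∏' s : ℕ, Real.sinc (q ^ s * y)
      = Real.sinc y * ∏' s : ℕ, Real.sinc (q ^ (s + 1) * y) := by
    simpa using tprod_eq_zero_mul' (f := fun s : ℕ => Real.sinc (q ^ s * y))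
      (multipliable_of_summable_abs_sub_one hsum)
  have hquot : 0 ≤ q / (1 - q) := div_nonneg hq (sub_nonneg.2 hq1.le)
  calc |∏' s : ℕ, Real.sinc (q ^ s * y) - Real.sinc y|
      = |Real.sinc y| * |∏' s : ℕ, Real.sinc (q ^ (s + 1) * y) - 1| := by
        rw [hsplit, ← abs_mul, mul_sub_one]
    _ ≤ |Real.sinc y| * (q / (1 - q) * |y|) := by gcongr
    _ = q / (1 - q) * (|Real.sinc y| * |y|) := by ring
    _ ≤ q / (1 - q) := mul_le_of_le_one_right hquot (abs_sinc_mul_abs_le_one y)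

end Sinc

section Psi

variable {ε : ℝ} (hε : 0 < ε) (hε' : ε < 1) (Ω : Set ℝ)

include hε hε'

theorem volume_real_smul_window (n s : ℕ) :
    volume.real (ε ^ (n * s) • ((1 - ε ^ n) • Ω))
      = (ε ^ n) ^ s * ((1 - ε ^ n) * volume.real Ω) := by
  have hnonneg : 0 ≤ 1 - ε ^ n := by linarith [pow_le_one₀ (n := n) hε.le hε'.le]
  rw [measureReal_def, Measure.addHaar_smul, Measure.addHaar_smul, measureReal_def]
  simp [abs_of_nonneg hnonneg, abs_of_pos hε, pow_mul, ENNReal.toReal_ofReal hnonneg,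
    ENNReal.toReal_ofReal (pow_nonneg (pow_nonneg hε.le _) _)]

theorem psiHat_eq_tprod_sinc (n : ℕ) (t : ℝ) :
    psiHat ε Ω n t
      = ∏' s : ℕ, Real.sinc ((ε ^ n) ^ s * ((1 - ε ^ n) * (Real.pi * (t * volume.real Ω)))) := by
  simp_rw [psiHat, volume_real_smul_window hε hε']
  refine tprod_congr fun s => congrArg Real.sinc ?_
  ring

theorem abs_psiHat_sub_sinc_le {n : ℕ} (hn : n ≠ 0) (t : ℝ) :
    |psiHat ε Ω n t - Real.sinc (Real.pi * (t * volume.real Ω))|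
      ≤ ε ^ n / (1 - ε ^ n) + 2 * ε ^ n := by
  have hq : 0 < ε ^ n := pow_pos hε n
  have hq1 : ε ^ n < 1 := pow_lt_one₀ hε.le hε' hn
  rw [psiHat_eq_tprod_sinc hε hε']
  refine (abs_sub_le _ _ _).trans
    (add_le_add (abs_tprod_sinc_pow_mul_sub_sinc_le hq.le hq1 _) ?_)
  refine (abs_sinc_mul_sub_sinc_le _ _).trans_eq ?_
  rw [sub_sub_cancel, abs_of_pos hq]

theorem tendstoUniformly_psiHat_sinc :
    TendstoUniformly (psiHat ε Ω) (fun t => Real.sinc (Real.pi * (t * volume.real Ω))) atTop := by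
  have hpow := tendsto_pow_atTop_nhds_zero_of_lt_one hε.le hε'
  have hlim : Tendsto (fun n : ℕ => ε ^ n / (1 - ε ^ n) + 2 * ε ^ n) atTop (𝓝 0) := by
    simpa using
      (hpow.div (tendsto_const_nhds (x := (1 : ℝ)) |>.sub hpow) (by norm_num)).add
        (hpow.const_mul 2)
  rw [Metric.tendstoUniformly_iff]
  intro δ hδ
  filter_upwards [hlim.eventually (gt_mem_nhds hδ), eventually_ne_atTop 0] with n hn hn0 t
  rw [dist_comm, Real.dist_eq]
  exact (abs_psiHat_sub_sinc_le hε hε' Ω hn0 t).trans_lt hn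

theorem Psi_eq_sinc : Psi ε Ω = fun t => Real.sinc (Real.pi * (t * volume.real Ω)) :=
  funext fun t => ((tendstoUniformly_psiHat_sinc hε hε' Ω).tendsto_at t).limUnder_eq

theorem tendstoUniformly_psiHat : TendstoUniformly (psiHat ε Ω) (Psi ε Ω) atTop := by
  rw [Psi_eq_sinc hε hε']
  exact tendstoUniformly_psiHat_sinc hε hε' Ω

end Psi

section IntervalIndicator

theorem intervalIntegral_exp_mul_I (r c : ℝ) :
    ∫ y in -r..r, Complex.exp ((y * c : ℝ) * Complex.I) = (2 * r * Real.sinc (r * c) : ℝ) := by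
  rcases eq_or_ne c 0 with rfl | hc
  · simp [two_mul]
  rw [intervalIntegral.integral_comp_mul_right (fun u : ℝ => Complex.exp (u * Complex.I)) hc,
    neg_mul, integral_exp_mul_I_eq_sinc, Complex.real_smul]
  have hc' : (c : ℂ) ≠ 0 := Complex.ofReal_ne_zero.2 hc
  push_cast
  field_simp

theorem fourier_indicator_Icc {a b : ℝ} (hab : a ≤ b) (ξ : ℝ) :
    𝓕 ((Set.Icc a b).indicator (1 : ℝ → ℂ)) ξ
      = Complex.exp ((-Real.pi * ((a + b) * ξ) : ℝ) * Complex.I)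
        * ((b - a) * Real.sinc (Real.pi * (ξ * (b - a))) : ℝ) := by
  have hcenter : ∫ y in a..b, Complex.exp ((-2 * Real.pi * (y * ξ) : ℝ) * Complex.I)
      = Complex.exp ((-Real.pi * ((a + b) * ξ) : ℝ) * Complex.I)
        * ∫ y in -((b - a) / 2)..(b - a) / 2,
          Complex.exp ((y * (-2 * Real.pi * ξ) : ℝ) * Complex.I) := by
    rw [← intervalIntegral.integral_const_mul]
    have hshift := intervalIntegral.integral_comp_add_right (a := -((b - a) / 2))
      (b := (b - a) / 2) (fun y => Complex.exp ((-2 * Real.pi * (y * ξ) : ℝ) * Complex.I))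
      ((a + b) / 2)
    have hl : -((b - a) / 2) + (a + b) / 2 = a := by ring
    have hr : (b - a) / 2 + (a + b) / 2 = b := by ring
    rw [hl, hr] at hshift
    rw [← hshift]
    refine intervalIntegral.integral_congr fun y _ => ?_
    simp only [← Complex.exp_add]
    congr 1
    push_cast
    ring
  have hradius : 2 * ((b - a) / 2) = b - a := by ring
  have hphase : (b - a) / 2 * (-2 * Real.pi * ξ) = -(Real.pi * (ξ * (b - a))) := by ring
  rw [intervalIntegral_exp_mul_I, hradius, hphase, Real.sinc_neg] at hcenter
  rw [← hcenter, intervalIntegral.integral_of_le hab, ← integral_Icc_eq_integral_Ioc,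
    ← integral_indicator measurableSet_Icc, Real.fourier_eq']
  refine integral_congr_ae (Eventually.of_forall fun y => ?_)
  by_cases hy : y ∈ Set.Icc a b
  · simp [Set.indicator_of_mem hy, mul_comm ξ]
  · simp [Set.indicator_of_notMem hy]

/-- The box function of length `w` centred at the origin, modulated by the frequency `ω`. -/
noncomputable def modulatedBox (w ω : ℝ) : ℝ → ℂ :=
  (Set.Icc (-(w / 2)) (w / 2)).indicator fun t =>
    Complex.exp ((2 * Real.pi * (ω * t) : ℝ) * Complex.I)

theorem memLp_modulatedBox (w ω : ℝ) (p : ℝ≥0∞) : MemLp (modulatedBox w ω) p := by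
  refine (memLp_indicator_const p (measurableSet_Icc (a := -(w / 2)) (b := w / 2)) (1 : ℂ)
    (Or.inr measure_Icc_lt_top.ne)).of_le ?_ (Eventually.of_forall fun t => ?_)
  · exact AEStronglyMeasurable.indicator (Continuous.aestronglyMeasurable (by fun_prop))
      measurableSet_Icc
  · rw [modulatedBox, norm_indicator_eq_indicator_norm, norm_indicator_eq_indicator_norm]
    simp only [Complex.norm_exp_ofReal_mul_I, norm_one, le_refl]

theorem integrable_modulatedBox (w ω : ℝ) : Integrable (modulatedBox w ω) :=
  memLp_one_iff_integrable.1 (memLp_modulatedBox w ω 1)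

theorem fourier_modulatedBox {w : ℝ} (hw : 0 ≤ w) (ω ξ : ℝ) :
    𝓕 (modulatedBox w ω) ξ = (w * Real.sinc (Real.pi * ((ξ - ω) * w)) : ℝ) := by
  have hshift : 𝓕 (modulatedBox w ω) ξ
      = 𝓕 ((Set.Icc (-(w / 2)) (w / 2)).indicator (1 : ℝ → ℂ)) (ξ - ω) := by
    rw [Real.fourier_eq', Real.fourier_eq']
    refine integral_congr_ae (Eventually.of_forall fun t => ?_)
    by_cases ht : t ∈ Set.Icc (-(w / 2)) (w / 2)
    · simp only [modulatedBox, Set.indicator_of_mem ht, smul_eq_mul, Pi.one_apply, mul_one]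
      rw [← Complex.exp_add]
      congr 1
      simp only [RCLike.inner_apply, conj_trivial]
      push_cast
      ring
    · simp [modulatedBox, Set.indicator_of_notMem ht]
  have hlen : w / 2 - -(w / 2) = w := by ring
  rw [hshift, fourier_indicator_Icc (by linarith), neg_add_cancel, hlen]
  simp

theorem inner_fourier_modulatedBox {w : ℝ} (hw : 0 ≤ w) (t x : ℝ) :
    ⟪𝓕 (modulatedBox w 0) x, 𝓕 (modulatedBox w t) x⟫_ℂ
      = ((w ^ 2 * (Real.sinc (Real.pi * (x * w)) * Real.sinc (Real.pi * ((t - x) * w))) : ℝ) :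
        ℂ) := by
  have hneg : Real.pi * ((t - x) * w) = -(Real.pi * ((x - t) * w)) := by ring
  rw [fourier_modulatedBox hw, fourier_modulatedBox hw, RCLike.inner_apply, Complex.conj_ofReal,
    sub_zero, hneg, Real.sinc_neg]
  push_cast
  ring

theorem memLp_two_sinc {w : ℝ} (hw : 0 < w) (t : ℝ) :
    MemLp (fun x => Real.sinc (Real.pi * ((x - t) * w))) 2 := by
  have hre := (memLp_fourier (integrable_modulatedBox w t) (memLp_modulatedBox w t 2)).re.const_mul
    w⁻¹
  simpa only [fourier_modulatedBox hw.le, RCLike.re_to_complex, Complex.ofReal_re,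
    inv_mul_cancel_left₀ hw.ne'] using hre

theorem integrable_sinc_mul_sinc {w : ℝ} (hw : 0 < w) (t : ℝ) :
    Integrable fun x : ℝ =>
      Real.sinc (Real.pi * (x * w)) * Real.sinc (Real.pi * ((t - x) * w)) := by
  have hneg : ∀ x, Real.sinc (Real.pi * ((x - t) * w)) = Real.sinc (Real.pi * ((t - x) * w)) :=
    fun x => by rw [← Real.sinc_neg, ← mul_neg, ← neg_mul, neg_sub]
  have hmul := (memLp_two_sinc hw 0).integrable_mul (memLp_two_sinc hw t)
  simp only [sub_zero, hneg] at hmul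
  exact hmul

theorem integral_sinc_mul_sinc {w : ℝ} (hw : 0 < w) (t : ℝ) :
    ∫ x : ℝ, Real.sinc (Real.pi * (x * w)) * Real.sinc (Real.pi * ((t - x) * w))
      = Real.sinc (Real.pi * (t * w)) / w := by
  have hinner : ∫ x, ⟪modulatedBox w 0 x, modulatedBox w t x⟫_ℂ
      = ((w * Real.sinc (Real.pi * (t * w)) : ℝ) : ℂ) := by
    have hzero := fourier_modulatedBox hw.le t 0
    rw [zero_sub, neg_mul, mul_neg, Real.sinc_neg] at hzero
    rw [← hzero, Real.fourier_eq']
    refine integral_congr_ae (Eventually.of_forall fun x => ?_)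
    by_cases hx : x ∈ Set.Icc (-(w / 2)) (w / 2)
    · simp [modulatedBox, Set.indicator_of_mem hx]
    · simp [modulatedBox, Set.indicator_of_notMem hx]
  have hplancherel := integral_inner_fourier (integrable_modulatedBox w 0)
    (memLp_modulatedBox w 0 2) (integrable_modulatedBox w t) (memLp_modulatedBox w t 2)
  simp_rw [inner_fourier_modulatedBox hw.le] at hplancherel
  rw [hinner, integral_complex_ofReal, integral_const_mul] at hplancherel
  have hreal := Complex.ofReal_injective hplancherel
  field_simp at hreal ⊢
  linarith

end IntervalIndicator

section Phi

variable {ε : ℝ} (hε : 0 < ε) (hε' : ε < 1) {Ω : Set ℝ} (hΩ : 0 < volume.real Ω)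

include hε hε' hΩ

theorem integrable_Psi_mul_Psi (t : ℝ) : Integrable fun x => Psi ε Ω x * Psi ε Ω (t - x) := by
  rw [Psi_eq_sinc hε hε']
  exact integrable_sinc_mul_sinc hΩ t

theorem Phi_eq_sinc (t : ℝ) : Phi ε Ω t = Real.sinc (Real.pi * (t * volume.real Ω)) := by
  rw [Phi, Psi_eq_sinc hε hε', integral_sinc_mul_sinc hΩ, mul_div_cancel₀ _ hΩ.ne']

end Phi

section SimpleWindow

variable {Ω : Set ℝ}

theorem IsSimpleWindow.nonempty_interior (hΩ : IsSimpleWindow Ω) : (interior Ω).Nonempty :=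
  closure_nonempty_iff.1 (by rw [hΩ.closure_interior]; exact hΩ.nonempty)

theorem IsSimpleWindow.exists_eq_Icc (hΩ : IsSimpleWindow Ω) :
    ∃ a b : ℝ, a < b ∧ Ω = Set.Icc a b := by
  have heq : Ω = Set.Icc (sInf Ω) (sSup Ω) :=
    Set.Subset.antisymm
      (fun x hx => ⟨csInf_le hΩ.isCompact.bddBelow hx, le_csSup hΩ.isCompact.bddAbove hx⟩)
      (hΩ.ordConnected.out (hΩ.isCompact.sInf_mem hΩ.nonempty)
        (hΩ.isCompact.sSup_mem hΩ.nonempty))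
  have hint := hΩ.nonempty_interior
  rw [heq, interior_Icc] at hint
  exact ⟨sInf Ω, sSup Ω, Set.nonempty_Ioo.1 hint, heq⟩

theorem IsSimpleWindow.volume_pos (hΩ : IsSimpleWindow Ω) : 0 < volume.real Ω := by
  obtain ⟨a, b, hab, rfl⟩ := hΩ.exists_eq_Icc
  rw [Real.volume_real_Icc_of_le hab.le]
  exact sub_pos.2 hab

end SimpleWindow

section LatticeCount

variable {V : Type*} [NormedAddCommGroup V] [MeasurableSpace V] {Γ : Submodule ℤ V}

/-- The counting measure of the lattice `Γ`, as a measure on the ambient space. -/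
noncomputable def latticeCount (Γ : Submodule ℤ V) : Measure V :=
  (Measure.count : Measure Γ).map (↑)

theorem latticeCount_apply {A : Set V} (hA : MeasurableSet A) :
    latticeCount Γ A = {γ : Γ | (γ : V) ∈ A}.encard := by
  rw [latticeCount, Measure.map_apply measurable_subtype_coe hA,
    Measure.count_apply (measurable_subtype_coe hA)]
  rfl

theorem latticeCount_le_of_translate {A A' : Set V} (hA : MeasurableSet A) (hA' : MeasurableSet A')
    {γ₀ : V} (hγ₀ : γ₀ ∈ Γ) (h : ∀ p ∈ A, p + γ₀ ∈ A') : latticeCount Γ A ≤ latticeCount Γ A' := by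
  rw [latticeCount_apply hA, latticeCount_apply hA']
  exact_mod_cast Set.encard_le_encard_of_injOn (f := fun γ : Γ => γ + (⟨γ₀, hγ₀⟩ : Γ))
    (fun γ hγ => h _ hγ) (add_left_injective _).injOn

variable [BorelSpace V]

theorem latticeCount_eq_tsum {A : Set V} (hA : MeasurableSet A) :
    latticeCount Γ A = ∑' γ : Γ, A.indicator 1 (γ : V) := by
  rw [latticeCount, ← lintegral_indicator_one hA,
    lintegral_map (measurable_one.indicator hA) measurable_subtype_coe, lintegral_count]

end LatticeCount

section Discrete

variable {V : Type*} [NormedAddCommGroup V] [ProperSpace V]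

theorem finite_lattice_inter_of_isBounded (Γ : Submodule ℤ V) [DiscreteTopology Γ]
    {A : Set V} (hA : Bornology.IsBounded A) :
    {γ : Γ | (γ : V) ∈ A}.Finite := by
  have hclosed : IsClosed (Γ : Set V) :=
    AddSubgroup.isClosed_of_discrete (H := Γ.toAddSubgroup)
  have h := Metric.finite_isBounded_inter_isClosed (s := (Γ : Set V)) DiscreteTopology.isDiscrete
    hA hclosed
  exact (h.preimage Subtype.val_injective.injOn).subset fun γ hγ => ⟨hγ, γ.2⟩

theorem latticeCount_lt_top [MeasurableSpace V] {Γ : Submodule ℤ V} [DiscreteTopology Γ] {A : Set V}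
    (hA : MeasurableSet A) (hb : Bornology.IsBounded A) :
    latticeCount Γ A < ∞ := by
  rw [latticeCount_apply hA]
  exact_mod_cast (finite_lattice_inter_of_isBounded Γ hb).encard_lt_top

end Discrete

section LatticeDomain

variable {V : Type*} [NormedAddCommGroup V] [NormedSpace ℝ V] [FiniteDimensional ℝ V]
  (Γ : Submodule ℤ V) [DiscreteTopology Γ] [IsZLattice ℝ Γ]

/-- A basis of the ambient space that spans the lattice `Γ` over the integers. -/
noncomputable def latticeBasis : Module.Basis (Module.Free.ChooseBasisIndex ℤ Γ) ℝ V :=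
  (Module.Free.chooseBasis ℤ Γ).ofZLatticeBasis ℝ

theorem span_range_latticeBasis : Submodule.span ℤ (Set.range (latticeBasis Γ)) = Γ :=
  (Module.Free.chooseBasis ℤ Γ).ofZLatticeBasis_span ℝ

/-- The half-open parallelepiped on a basis of `Γ`, a bounded fundamental domain of `Γ`. -/
noncomputable def latticeDomain : Set V :=
  ZSpan.fundamentalDomain (latticeBasis Γ)

theorem isBounded_latticeDomain : Bornology.IsBounded (latticeDomain Γ) :=
  ZSpan.fundamentalDomain_isBounded _

theorem existsUnique_add_mem_latticeDomain (z : V) : ∃! γ : Γ, (γ : V) + z ∈ latticeDomain Γ := by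
  have h := ZSpan.exist_unique_vadd_mem_fundamentalDomain (latticeBasis Γ) z
  rw [span_range_latticeBasis] at h
  exact h

variable [MeasurableSpace V]

theorem measure_latticeDomain_ne_top (μ : Measure V) [IsFiniteMeasureOnCompacts μ] :
    μ (latticeDomain Γ) ≠ ∞ :=
  (isBounded_latticeDomain Γ).measure_lt_top.ne

variable [BorelSpace V]

instance (μ : Measure V) [μ.IsAddHaarMeasure] : VAddInvariantMeasure Γ V μ :=
  inferInstanceAs (VAddInvariantMeasure Γ.toAddSubgroup V μ)

theorem isAddFundamentalDomain_latticeDomain (μ : Measure V) :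
    IsAddFundamentalDomain Γ (latticeDomain Γ) μ :=
  ZLattice.isAddFundamentalDomain _ μ

theorem measurableSet_latticeDomain : MeasurableSet (latticeDomain Γ) :=
  ZSpan.fundamentalDomain_measurableSet _

section Measure

variable (μ : Measure V) [μ.IsAddHaarMeasure]

theorem measureReal_latticeDomain : μ.real (latticeDomain Γ) = ZLattice.covolume Γ μ :=
  (ZLattice.covolume_eq_measure_fundamentalDomain Γ μ
    (isAddFundamentalDomain_latticeDomain Γ μ)).symm

end Measure

variable {Γ}

theorem latticeCount_mul_le {A A' : Set V} (hA : MeasurableSet A) (μ : Measure V)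
    [μ.IsAddHaarMeasure] (h : ∀ p ∈ A, ∀ d ∈ latticeDomain Γ, p + d ∈ A') :
    latticeCount Γ A * μ (latticeDomain Γ) ≤ μ A' := by
  rw [(isAddFundamentalDomain_latticeDomain Γ μ).measure_eq_tsum' A', latticeCount_eq_tsum hA,
    ← ENNReal.tsum_mul_right]
  refine ENNReal.tsum_le_tsum fun γ => ?_
  by_cases hγ : (γ : V) ∈ A
  · have hsub : γ +ᵥ latticeDomain Γ ⊆ A' := by
      rintro _ ⟨d, hd, rfl⟩
      exact h _ hγ d hd
    have hμ : μ (γ +ᵥ latticeDomain Γ) = μ (latticeDomain Γ) := measure_vadd μ (γ : V) _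
    rw [Set.inter_eq_right.2 hsub, Set.indicator_of_mem hγ, hμ, Pi.one_apply, one_mul]
  · simp [Set.indicator_of_notMem hγ]

theorem le_latticeCount_mul {A A' : Set V} (hA : MeasurableSet A) (μ : Measure V)
    [μ.IsAddHaarMeasure] (h : ∀ p, ∀ d ∈ latticeDomain Γ, p + d ∈ A' → p ∈ A) :
    μ A' ≤ latticeCount Γ A * μ (latticeDomain Γ) := by
  rw [(isAddFundamentalDomain_latticeDomain Γ μ).measure_eq_tsum' A', latticeCount_eq_tsum hA,
    ← ENNReal.tsum_mul_right]
  refine ENNReal.tsum_le_tsum fun γ => ?_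
  by_cases hγ : (γ : V) ∈ A
  · have hμ : μ (γ +ᵥ latticeDomain Γ) = μ (latticeDomain Γ) := measure_vadd μ (γ : V) _
    rw [Set.indicator_of_mem hγ, Pi.one_apply, one_mul, ← hμ]
    exact measure_mono Set.inter_subset_right
  · have hdisj : A' ∩ (γ +ᵥ latticeDomain Γ) = ∅ := by
      rw [← Set.disjoint_iff_inter_eq_empty, Set.disjoint_right]
      rintro _ ⟨d, hd, rfl⟩ hz
      exact hγ (h _ d hd hz)
    simp [hdisj]

end LatticeDomain

section ModelSet

theorem measure_prod_Ioc_eq_sum {X : Type*} [MeasurableSpace X] (μ : Measure (X × ℝ)) {A : Set X}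
    (hA : MeasurableSet A) (a : ℝ) {s : ℝ} (hs : 0 ≤ s) (K : ℕ) :
    μ (A ×ˢ Set.Ioc a (a + K * s))
      = ∑ j ∈ Finset.range K, μ (A ×ˢ Set.Ioc (a + j * s) (a + j * s + s)) := by
  have hmono : Monotone fun j : ℕ => a + j * s := fun i j hij => by dsimp only; gcongr
  have hsucc : ∀ j : ℕ, a + (Order.succ j : ℕ) * s = a + j * s + s := fun j => by
    push_cast [Nat.succ_eq_succ]; ring
  have hunion := hmono.biUnion_Ico_Ioc_map_succ 0 K
  have hdisj := hmono.pairwise_disjoint_on_Ioc_succ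
  simp only [hsucc, Nat.cast_zero, zero_mul, add_zero] at hunion hdisj
  rw [← hunion, Set.prod_iUnion₂, ← Nat.Ico_zero_eq_range]
  refine (congrArg μ ?_).trans (measure_biUnion_finset
    (fun i _ j _ hij => Set.disjoint_prod.2 (Or.inr (hdisj hij)))
    fun j _ => hA.prod measurableSet_Ioc)
  simp

/-- The additive errors `C` and `q` disappear on letting first `R` and then `K` tend to infinity. -/
theorem eventually_div_pow_lt {m : ℕ} {N : ℝ → ℝ} {s q u : ℝ} (hu : s < u)
    (h : ∀ K : ℕ, ∃ C : ℝ, ∀ᶠ R in atTop, K * N R ≤ (R + C) ^ m * (K * s + q)) :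
    ∀ᶠ R in atTop, N R / R ^ m < u := by
  have hlim : Tendsto (fun K : ℕ => s + q / K) atTop (𝓝 (s + 0)) :=
    (tendsto_const_div_atTop_nhds_zero_nat q).const_add s
  rw [add_zero] at hlim
  obtain ⟨K, hKu, hK⟩ := ((hlim.eventually (gt_mem_nhds hu)).and (eventually_gt_atTop 0)).exists
  have hK' : (0 : ℝ) < K := by exact_mod_cast hK
  obtain ⟨C, hC⟩ := h K
  have hR : Tendsto (fun R : ℝ => (1 + C * R⁻¹) ^ m * (s + q / K)) atTop
      (𝓝 ((1 + C * 0) ^ m * (s + q / K))) :=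
    (((tendsto_inv_atTop_zero.const_mul C).const_add 1).pow m).mul_const _
  rw [mul_zero, add_zero, one_pow, one_mul] at hR
  filter_upwards [hR.eventually (gt_mem_nhds hKu), hC, eventually_gt_atTop 0] with R hlt hle hpos
  refine lt_of_le_of_lt ?_ hlt
  rw [div_le_iff₀ (pow_pos hpos m)]
  have hscale : (1 + C * R⁻¹) ^ m * R ^ m = (R + C) ^ m := by
    rw [← mul_pow]; congr 1; field_simp
  calc N R ≤ (R + C) ^ m * (K * s + q) / K := by rwa [le_div_iff₀ hK', mul_comm]
    _ = (R + C) ^ m * (s + q / K) := by field_simp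
    _ = (1 + C * R⁻¹) ^ m * (s + q / K) * R ^ m := by rw [← hscale]; ring

variable {m : ℕ}

theorem cube_eq_preimage (x : Rm m) (R : ℝ) :
    cube x R = WithLp.ofLp ⁻¹' Set.pi Set.univ fun i => Set.Icc (x i) (x i + R) := by
  ext y
  simp [cube, -Set.pi_univ_Icc]

theorem measurableSet_cube (x : Rm m) (R : ℝ) : MeasurableSet (cube x R) := by
  rw [cube_eq_preimage]
  exact (PiLp.volume_preserving_ofLp (Fin m)).measurable
    (MeasurableSet.univ_pi fun _ => measurableSet_Icc)

theorem volume_cube (x : Rm m) (R : ℝ) : volume (cube x R) = ENNReal.ofReal R ^ m := by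
  rw [cube_eq_preimage, (PiLp.volume_preserving_ofLp (Fin m)).measure_preimage
    (MeasurableSet.univ_pi fun _ => measurableSet_Icc).nullMeasurableSet, volume_pi, Measure.pi_pi]
  simp

theorem isBounded_cube (x : Rm m) (R : ℝ) : Bornology.IsBounded (cube x R) := by
  rw [cube_eq_preimage]
  exact (PiLp.antilipschitzWith_ofLp 2 _).isBounded_preimage
    (Bornology.IsBounded.pi fun _ => Metric.isBounded_Icc _ _)

/-- The cube of side `R + 2 C` concentric with `cube x R`; it is smaller than `cube x R` when
`C < 0`. -/
def thickenedCube (x : Rm m) (R C : ℝ) : Set (Rm m) :=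
  cube (WithLp.toLp 2 fun i => x i - C) (R + 2 * C)

theorem thickenedCube_zero (x : Rm m) (R : ℝ) : thickenedCube x R 0 = cube x R := by
  simp [thickenedCube]

theorem measurableSet_thickenedCube (x : Rm m) (R C : ℝ) : MeasurableSet (thickenedCube x R C) :=
  measurableSet_cube _ _

theorem add_mem_thickenedCube {x y d : Rm m} {R C r : ℝ} (hy : y ∈ thickenedCube x R C)
    (hd : ‖d‖ ≤ r) : y + d ∈ thickenedCube x R (C + r) := by
  intro i
  obtain ⟨hlo, hup⟩ := hy i
  obtain ⟨hlo', hup'⟩ := abs_le.1 ((PiLp.norm_apply_le d i).trans hd)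
  simp only [PiLp.add_apply] at hlo hup ⊢
  constructor <;> linarith

theorem mem_thickenedCube_of_add_mem {x y d : Rm m} {R C r : ℝ} (hd : ‖d‖ ≤ r)
    (h : y + d ∈ thickenedCube x R (C - r)) : y ∈ thickenedCube x R C := by
  simpa using add_mem_thickenedCube h ((norm_neg d).trans_le hd)

theorem volume_thickenedCube_prod_Ioc (x : Rm m) (R C a b : ℝ) :
    volume (thickenedCube x R C ×ˢ Set.Ioc a b)
      = ENNReal.ofReal (R + 2 * C) ^ m * ENNReal.ofReal (b - a) := by
  rw [Measure.volume_eq_prod, Measure.prod_prod, thickenedCube, volume_cube, Real.volume_Ioc]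

instance : (volume : Measure (Rm m × ℝ)).IsAddHaarMeasure := by
  rw [Measure.volume_eq_prod]; infer_instance

variable {Γ : Submodule ℤ (Rm m × ℝ)}

section Translate

theorem latticeCount_thickenedCube_prod_le {γ : Rm m × ℝ} (hγ : γ ∈ Γ) {I J : Set ℝ}
    (hI : MeasurableSet I) (hJ : MeasurableSet J) (h : ∀ y ∈ I, y + γ.2 ∈ J) (x : Rm m) (R C : ℝ)
    {r : ℝ} (hr : ‖γ.1‖ ≤ r) :
    latticeCount Γ (thickenedCube x R C ×ˢ I) ≤ latticeCount Γ (thickenedCube x R (C + r) ×ˢ J) :=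
  latticeCount_le_of_translate ((measurableSet_thickenedCube x R C).prod hI)
    ((measurableSet_thickenedCube x R _).prod hJ) hγ
    fun _ hp => ⟨add_mem_thickenedCube hp.1 hr, h _ hp.2⟩

variable (hdense : Dense (Prod.snd '' (Γ : Set (Rm m × ℝ))))
include hdense

theorem exists_lattice_snd_mem_Ioo {p q : ℝ} (h : p < q) : ∃ γ ∈ Γ, p < γ.2 ∧ γ.2 < q := by
  obtain ⟨_, ⟨γ, hγ, rfl⟩, hlo, hup⟩ := hdense.exists_between h
  exact ⟨γ, hγ, hlo, hup⟩

theorem eventually_latticeCount_Icc_le {a b s : ℝ} (hs : b - a < s) (t : ℝ) :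
    ∀ᶠ C in atTop, ∀ (x : Rm m) (R : ℝ), latticeCount Γ (cube x R ×ˢ Set.Icc a b)
      ≤ latticeCount Γ (thickenedCube x R C ×ˢ Set.Ioc t (t + s)) := by
  obtain ⟨γ, hγ, hlo, hup⟩ := exists_lattice_snd_mem_Ioo hdense
    (p := t - a) (q := t + s - b) (by linarith)
  filter_upwards [eventually_ge_atTop ‖γ.1‖] with C hC x R
  rw [← thickenedCube_zero]
  convert latticeCount_thickenedCube_prod_le hγ measurableSet_Icc measurableSet_Ioc
    (fun y hy => ⟨?_, ?_⟩) x R 0 hC using 3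
  · rw [zero_add]
  · linarith [hy.1]
  · linarith [hy.2]

theorem eventually_latticeCount_Ioc_le {a b s : ℝ} (hs : s < b - a) (t : ℝ) :
    ∀ᶠ C in atTop, ∀ (x : Rm m) (R : ℝ),
      latticeCount Γ (thickenedCube x R (-C) ×ˢ Set.Ioc t (t + s))
        ≤ latticeCount Γ (cube x R ×ˢ Set.Icc a b) := by
  obtain ⟨γ, hγ, hlo, hup⟩ := exists_lattice_snd_mem_Ioo hdense
    (p := a - t) (q := b - t - s) (by linarith)
  filter_upwards [eventually_ge_atTop ‖γ.1‖] with C hC x R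
  rw [← thickenedCube_zero]
  convert latticeCount_thickenedCube_prod_le hγ measurableSet_Ioc measurableSet_Icc
    (fun y hy => ⟨?_, ?_⟩) x R (-C) hC using 3
  · rw [neg_add_cancel]
  · linarith [hy.1]
  · linarith [hy.2]

/-- Packing: `K` lattice translates of the box fit side by side over an interval of length
`K s`. -/
theorem exists_mul_latticeCount_le {a b s : ℝ} (hs : b - a < s) (hs0 : 0 ≤ s) (K : ℕ) :
    ∃ C : ℝ, 0 ≤ C ∧ ∀ (x : Rm m) (R : ℝ), K * latticeCount Γ (cube x R ×ˢ Set.Icc a b)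
      ≤ latticeCount Γ (thickenedCube x R C ×ˢ Set.Ioc a (a + K * s)) := by
  obtain ⟨C, hC, hC0⟩ := (((Finset.range K).eventually_all.2 fun j _ =>
    eventually_latticeCount_Icc_le hdense hs (a + j * s)).and (eventually_ge_atTop 0)).exists
  refine ⟨C, hC0, fun x R => ?_⟩
  rw [measure_prod_Ioc_eq_sum _ (measurableSet_thickenedCube x R C) a hs0]
  simpa using Finset.card_nsmul_le_sum (Finset.range K) _ _ fun j hj => hC j hj x R

/-- Covering: an interval of length `K s` is covered by `K` lattice translates of the box. -/
theorem exists_latticeCount_le_mul {a b s : ℝ} (hs : s < b - a) (hs0 : 0 ≤ s) (K : ℕ) :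
    ∃ C : ℝ, ∀ (x : Rm m) (R : ℝ),
      latticeCount Γ (thickenedCube x R (-C) ×ˢ Set.Ioc a (a + K * s))
        ≤ K * latticeCount Γ (cube x R ×ˢ Set.Icc a b) := by
  obtain ⟨C, hC⟩ := ((Finset.range K).eventually_all.2 fun j _ =>
    eventually_latticeCount_Ioc_le hdense hs (a + j * s)).exists
  refine ⟨C, fun x R => ?_⟩
  rw [measure_prod_Ioc_eq_sum _ (measurableSet_thickenedCube x R (-C)) a hs0]
  simpa using Finset.sum_le_card_nsmul (Finset.range K) _ _ fun j hj => hC j hj x R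

end Translate

theorem ncard_modelSet_inter (hinj : Set.InjOn Prod.fst (Γ : Set (Rm m × ℝ))) {A : Set (Rm m)}
    {W : Set ℝ} (hA : MeasurableSet A) (hW : MeasurableSet W) :
    ((modelSet Γ W ∩ A).ncard : ℝ) = (latticeCount Γ).real (A ×ˢ W) := by
  have himage : modelSet Γ W ∩ A
      = (fun γ : Γ => (γ : Rm m × ℝ).1) '' {γ : Γ | (γ : Rm m × ℝ) ∈ A ×ˢ W} := by
    ext z
    constructor
    · rintro ⟨⟨γ, ⟨hγ, hγW⟩, rfl⟩, hγA⟩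
      exact ⟨⟨γ, hγ⟩, ⟨hγA, hγW⟩, rfl⟩
    · rintro ⟨γ, ⟨hγA, hγW⟩, rfl⟩
      exact ⟨⟨γ, ⟨γ.2, hγW⟩, rfl⟩, hγA⟩
  have hinj' : Set.InjOn (fun γ : Γ => (γ : Rm m × ℝ).1) {γ : Γ | (γ : Rm m × ℝ) ∈ A ×ˢ W} :=
    fun γ _ γ' _ h => Subtype.ext (hinj γ.2 γ'.2 h)
  rw [himage, hinj'.ncard_image, Measure.real, latticeCount_apply (hA.prod hW), Set.ncard_def]
  cases {γ : Γ | (γ : Rm m × ℝ) ∈ A ×ˢ W}.encard using ENat.recTopCoe <;> simp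

variable [DiscreteTopology Γ] [IsZLattice ℝ Γ]

theorem exists_latticeDomain_bound :
    ∃ c : ℝ, 0 ≤ c ∧ ∀ d ∈ latticeDomain Γ, ‖d.1‖ ≤ c ∧ |d.2| ≤ c := by
  obtain ⟨c, hc⟩ := (isBounded_latticeDomain Γ).exists_norm_le
  refine ⟨max c 0, le_max_right _ _, fun d hd => ?_⟩
  have h := (hc d hd).trans (le_max_left c 0)
  exact ⟨(norm_fst_le d).trans h, (norm_snd_le d).trans h⟩

section Volume

variable {c : ℝ} (hc : ∀ d ∈ latticeDomain Γ, ‖d.1‖ ≤ c ∧ |d.2| ≤ c)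
include hc

theorem latticeCount_mul_covolume_le (x : Rm m) (R C a b : ℝ) :
    latticeCount Γ (thickenedCube x R C ×ˢ Set.Ioc a b) * volume (latticeDomain Γ)
      ≤ ENNReal.ofReal (R + 2 * (C + c)) ^ m * ENNReal.ofReal (b + c - (a - c)) := by
  rw [← volume_thickenedCube_prod_Ioc x]
  refine latticeCount_mul_le ((measurableSet_thickenedCube x R C).prod measurableSet_Ioc) _
    fun p hp d hd => ⟨add_mem_thickenedCube hp.1 (hc d hd).1, ?_, ?_⟩ <;>
  · obtain ⟨hlo, hup⟩ := abs_le.1 (hc d hd).2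
    have := hp.2.1
    have := hp.2.2
    simp only [Prod.snd_add]
    linarith

theorem le_latticeCount_mul_covolume (x : Rm m) (R C a b : ℝ) :
    ENNReal.ofReal (R + 2 * (C - c)) ^ m * ENNReal.ofReal (b - c - (a + c))
      ≤ latticeCount Γ (thickenedCube x R C ×ˢ Set.Ioc a b) * volume (latticeDomain Γ) := by
  rw [← volume_thickenedCube_prod_Ioc x]
  refine le_latticeCount_mul ((measurableSet_thickenedCube x R C).prod measurableSet_Ioc) _
    fun p d hd hpd => ⟨mem_thickenedCube_of_add_mem (hc d hd).1 hpd.1, ?_, ?_⟩ <;>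
  · obtain ⟨hlo, hup⟩ := abs_le.1 (hc d hd).2
    have hlo' := hpd.2.1
    have hup' := hpd.2.2
    simp only [Prod.snd_add] at hlo' hup'
    linarith

end Volume

section Density

variable (hdense : Dense (Prod.snd '' (Γ : Set (Rm m × ℝ))))
include hdense

theorem exists_latticeCount_mul_covolume_le {a b s : ℝ} (hs : b - a < s) (hs0 : 0 ≤ s) :
    ∃ q : ℝ, ∀ K : ℕ, ∃ C : ℝ, ∀ x : Rm m, ∀ᶠ R in atTop,
      K * ((latticeCount Γ).real (cube x R ×ˢ Set.Icc a b) * ZLattice.covolume Γ)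
        ≤ (R + C) ^ m * (K * s + q) := by
  obtain ⟨c, hc0, hc⟩ := exists_latticeDomain_bound (Γ := Γ)
  refine ⟨2 * c, fun K => ?_⟩
  obtain ⟨C, hC0, hC⟩ := exists_mul_latticeCount_le hdense hs hs0 K
  refine ⟨2 * (C + c), fun x => ?_⟩
  filter_upwards [eventually_ge_atTop 0] with R hR
  have h := ENNReal.toReal_mono (by finiteness) ((mul_le_mul_left (hC x R) _).trans
    (latticeCount_mul_covolume_le hc x R C a (a + K * s)))
  rw [← measureReal_latticeDomain, ← mul_assoc]
  convert h using 1
  · simp [Measure.real]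
  · rw [ENNReal.toReal_mul, ENNReal.toReal_pow, ENNReal.toReal_ofReal (by positivity),
      ENNReal.toReal_ofReal (by linarith [mul_nonneg K.cast_nonneg hs0])]
    ring

theorem exists_le_latticeCount_mul_covolume {a b s : ℝ} (hs : s < b - a) (hs0 : 0 ≤ s) :
    ∃ q : ℝ, ∀ K : ℕ, ∃ C : ℝ, ∀ x : Rm m, ∀ᶠ R in atTop, (R + C) ^ m * (K * s - q)
      ≤ K * ((latticeCount Γ).real (cube x R ×ˢ Set.Icc a b) * ZLattice.covolume Γ) := by
  obtain ⟨c, -, hc⟩ := exists_latticeDomain_bound (Γ := Γ)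
  refine ⟨2 * c, fun K => ?_⟩
  obtain ⟨C, hC⟩ := exists_latticeCount_le_mul hdense hs hs0 K
  refine ⟨-2 * (C + c), fun x => ?_⟩
  filter_upwards [eventually_ge_atTop (2 * (C + c))] with R hR
  have hfin : latticeCount Γ (cube x R ×ˢ Set.Icc a b) ≠ ∞ :=
    (latticeCount_lt_top ((measurableSet_cube x R).prod measurableSet_Icc)
      ((isBounded_cube x R).prod (Metric.isBounded_Icc a b))).ne
  have hvol := measure_latticeDomain_ne_top Γ volume
  have h := ENNReal.toReal_mono (by finiteness)
    ((le_latticeCount_mul_covolume hc x R (-C) a (a + K * s)).trans (mul_le_mul_left (hC x R) _))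
  rw [ENNReal.toReal_mul, ENNReal.toReal_pow, ENNReal.toReal_ofReal (by linarith),
    ENNReal.toReal_ofReal', ENNReal.toReal_mul, ENNReal.toReal_mul, ENNReal.toReal_natCast] at h
  rw [← measureReal_latticeDomain, ← mul_assoc]
  refine le_trans ?_ h
  convert mul_le_mul_of_nonneg_left (le_max_left _ 0)
    (pow_nonneg (by linarith : 0 ≤ R + 2 * (-C - c)) m) using 1
  ring

theorem hasDensity_modelSet (hinj : Set.InjOn Prod.fst (Γ : Set (Rm m × ℝ))) {a b : ℝ}
    (hab : a < b) : HasDensity (modelSet Γ (Set.Icc a b)) ((b - a) / ZLattice.covolume Γ) := by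
  have hv := ZLattice.covolume_pos Γ (volume : Measure (Rm m × ℝ))
  intro x
  simp_rw [ncard_modelSet_inter hinj (measurableSet_cube x _) measurableSet_Icc]
  rw [tendsto_order]
  constructor
  · intro u hu
    obtain ⟨s, hs, hs'⟩ := exists_between (max_lt (sub_pos.2 hab) ((lt_div_iff₀ hv).1 hu))
    rw [max_lt_iff] at hs
    obtain ⟨q, hq⟩ := exists_le_latticeCount_mul_covolume hdense hs' hs.1.le
    have h := eventually_div_pow_lt (q := q) (neg_lt_neg hs.2)
      (N := fun R => -((latticeCount Γ).real (cube x R ×ˢ Set.Icc a b) * ZLattice.covolume Γ))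
      fun K => by
        obtain ⟨C, hC⟩ := hq K
        exact ⟨C, (hC x).mono fun R h => by linarith⟩
    filter_upwards [h] with R hR
    rw [neg_div, neg_lt_neg_iff, mul_div_right_comm] at hR
    exact lt_of_mul_lt_mul_right hR hv.le
  · intro u hu
    obtain ⟨s, hs, hs'⟩ := exists_between ((div_lt_iff₀ hv).1 hu)
    obtain ⟨q, hq⟩ := exists_latticeCount_mul_covolume_le hdense hs ((sub_pos.2 hab).trans hs).le
    have h := eventually_div_pow_lt hs' fun K => (hq K).imp fun C hC => hC x
    filter_upwards [h] with R hR
    rw [mul_div_right_comm] at hR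
    exact lt_of_mul_lt_mul_right hR hv.le

theorem density_modelSet (hinj : Set.InjOn Prod.fst (Γ : Set (Rm m × ℝ))) {a b : ℝ}
    (hab : a < b) : density (modelSet Γ (Set.Icc a b)) = (b - a) / ZLattice.covolume Γ :=
  (hasDensity_modelSet hdense hinj hab 0).limUnder_eq

theorem hasDensity_density_modelSet (hinj : Set.InjOn Prod.fst (Γ : Set (Rm m × ℝ))) {Ω : Set ℝ}
    (hΩ : IsSimpleWindow Ω) : HasDensity (modelSet Γ Ω) (density (modelSet Γ Ω)) := by
  obtain ⟨a, b, hab, rfl⟩ := hΩ.exists_eq_Icc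
  rw [density_modelSet hdense hinj hab]
  exact hasDensity_modelSet hdense hinj hab

end Density

end ModelSet

section Tsum

variable {α ι : Type*} [MeasurableSpace α] {μ : Measure α} [Countable ι] {f : ι → α → ℂ}

theorem ae_summable_of_tsum_lintegral_ne_top (hf : ∀ i, AEStronglyMeasurable (f i) μ)
    (hf' : ∑' i, ∫⁻ a, ‖f i a‖ₑ ∂μ ≠ ∞) : ∀ᵐ a ∂μ, Summable fun i => ‖f i a‖ := by
  rw [← lintegral_tsum fun i => (hf i).enorm] at hf'
  filter_upwards [ae_lt_top' (AEMeasurable.tsum fun i => (hf i).enorm) hf'] with a ha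
  exact tsum_enorm_ne_top_iff_summable_norm.1 ha.ne

theorem aestronglyMeasurable_tsum (hf : ∀ i, AEStronglyMeasurable (f i) μ)
    (hs : ∀ᵐ a ∂μ, Summable fun i => f i a) : AEStronglyMeasurable (fun a => ∑' i, f i a) μ :=
  aestronglyMeasurable_of_tendsto_ae atTop
    (fun s => Finset.aestronglyMeasurable_fun_sum s fun i _ => hf i)
    (hs.mono fun _ ha => ha.hasSum)

theorem integrable_tsum (hf : ∀ i, AEStronglyMeasurable (f i) μ)
    (hf' : ∑' i, ∫⁻ a, ‖f i a‖ₑ ∂μ ≠ ∞) : Integrable (fun a => ∑' i, f i a) μ := by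
  refine ⟨aestronglyMeasurable_tsum hf
    ((ae_summable_of_tsum_lintegral_ne_top hf hf').mono fun _ ha => ha.of_norm), ?_⟩
  refine (lintegral_mono fun a => enorm_tsum_le_tsum_enorm).trans_lt ?_
  rw [lintegral_tsum fun i => (hf i).enorm]
  exact hf'.lt_top

end Tsum

theorem aestronglyMeasurable_comp_add_left {G E : Type*} [AddGroup G] [MeasurableSpace G]
    [MeasurableAdd G] [TopologicalSpace E] {μ : Measure G} [μ.IsAddLeftInvariant] {f : G → E}
    (hf : AEStronglyMeasurable f μ) (g : G) : AEStronglyMeasurable (fun z => f (g + z)) μ :=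
  hf.comp_quasiMeasurePreserving (measurePreserving_add_left μ g).quasiMeasurePreserving

section LatticeCharacters

variable {V : Type*} [NormedAddCommGroup V] [NormedSpace ℝ V] {Γ : Submodule ℤ V}

/-- The functional `l` takes integer values on the lattice `Γ`, i.e. represents a point of the
dual lattice. -/
def IsIntegralOn (Γ : Submodule ℤ V) (l : V →L[ℝ] ℝ) : Prop := ∀ γ ∈ Γ, ∃ k : ℤ, l γ = k

theorem isIntegralOn_zero : IsIntegralOn Γ 0 := fun _ _ => ⟨0, by simp⟩

/-- The character `z ↦ e^{-2πi l(z)}` attached to the functional `l`. -/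
noncomputable def linChar (l : V →L[ℝ] ℝ) (z : V) : ℂ :=
  Complex.exp ((-2 * Real.pi * l z : ℝ) * Complex.I)

@[simp]
theorem linChar_zero_left (z : V) : linChar (0 : V →L[ℝ] ℝ) z = 1 := by
  simp [linChar]

theorem continuous_linChar (l : V →L[ℝ] ℝ) : Continuous (linChar l) := by
  unfold linChar
  fun_prop

theorem norm_linChar (l : V →L[ℝ] ℝ) (z : V) : ‖linChar l z‖ = 1 :=
  Complex.norm_exp_ofReal_mul_I _

theorem linChar_add (l : V →L[ℝ] ℝ) (z w : V) : linChar l (z + w) = linChar l z * linChar l w := by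
  rw [linChar, linChar, linChar, ← Complex.exp_add]
  congr 1
  push_cast [map_add]
  ring

theorem linChar_eq_one_of_mem {l : V →L[ℝ] ℝ} (hl : IsIntegralOn Γ l) {γ : V} (hγ : γ ∈ Γ) :
    linChar l γ = 1 := by
  obtain ⟨k, hk⟩ := hl γ hγ
  rw [linChar, hk, Complex.exp_eq_one_iff]
  exact ⟨-k, by push_cast; ring⟩

theorem linChar_add_of_mem {l : V →L[ℝ] ℝ} (hl : IsIntegralOn Γ l) {γ : V} (hγ : γ ∈ Γ) (z : V) :
    linChar l (γ + z) = linChar l z := by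
  rw [linChar_add, linChar_eq_one_of_mem hl hγ, one_mul]

theorem exists_linChar_eq_neg_one {l : V →L[ℝ] ℝ} (hl : l ≠ 0) : ∃ a, linChar l a = -1 := by
  obtain ⟨v, hv⟩ := DFunLike.ne_iff.1 hl
  have hlv : l v ≠ 0 := hv
  refine ⟨(1 / (2 * l v)) • v, ?_⟩
  rw [linChar, Complex.exp_eq_exp_iff_exists_int.2 ⟨-1, ?_⟩, Complex.exp_pi_mul_I]
  rw [map_smul, smul_eq_mul, one_div_mul_eq_div, div_mul_cancel_right₀ hlv]
  push_cast
  ring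

theorem integrable_mul_linChar [MeasurableSpace V] [BorelSpace V] [SecondCountableTopology V]
    {μ : Measure V} {H : V → ℂ} (hH : Integrable H μ) (l : V →L[ℝ] ℝ) :
    Integrable (fun z => H z * linChar l z) μ :=
  hH.mul_bdd (c := 1) (continuous_linChar l).aestronglyMeasurable
    (Eventually.of_forall fun z => (norm_linChar l z).le)

end LatticeCharacters

section Torus

variable {V : Type*} [NormedAddCommGroup V] [NormedSpace ℝ V] [FiniteDimensional ℝ V]
  {Γ : Submodule ℤ V} [DiscreteTopology Γ] [IsZLattice ℝ Γ]

/-- The quotient map onto the torus `V / Γ`, in the coordinates of a basis of the lattice. -/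
noncomputable def torusMap (Γ : Submodule ℤ V) [DiscreteTopology Γ] [IsZLattice ℝ Γ] (z : V) :
    UnitAddTorus (Module.Free.ChooseBasisIndex ℤ Γ) :=
  fun i => (((latticeBasis Γ).repr z i : ℝ) : UnitAddCircle)

theorem isOpenQuotientMap_torusMap : IsOpenQuotientMap (torusMap Γ) :=
  (IsOpenQuotientMap.piMap fun _ => QuotientAddGroup.isOpenQuotientMap_mk).comp
    (latticeBasis Γ).equivFunL.toHomeomorph.isOpenQuotientMap

theorem exists_lattice_of_torusMap_eq {z w : V} (h : torusMap Γ z = torusMap Γ w) :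
    ∃ γ : Γ, w = γ + z := by
  have hcoord : ∀ i, ∃ k : ℤ, (latticeBasis Γ).repr w i - (latticeBasis Γ).repr z i = k := by
    intro i
    obtain ⟨k, hk⟩ := (AddCircle.coe_eq_zero_iff 1).1
      ((AddCircle.coe_sub 1 _ _).trans (sub_eq_zero.2 (congrFun h.symm i)))
    exact ⟨k, by simpa using hk.symm⟩
  choose k hk using hcoord
  refine ⟨∑ i, k i • Module.Free.chooseBasis ℤ Γ i,
    sub_eq_iff_eq_add.1 ((latticeBasis Γ).repr.injective ?_)⟩
  ext i
  rw [map_sub, Finsupp.sub_apply, hk, latticeBasis, Module.Basis.ofZLatticeBasis_repr_apply]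
  simp [Finsupp.single_apply]

theorem exists_mFourier_torusMap_eq_linChar (n : Module.Free.ChooseBasisIndex ℤ Γ → ℤ) :
    ∃ l : V →L[ℝ] ℝ, IsIntegralOn Γ l ∧
      ∀ z, UnitAddTorus.mFourier n (torusMap Γ z) = linChar l z := by
  let l : V →L[ℝ] ℝ := LinearMap.toContinuousLinearMap
    (-∑ i, (n i : ℝ) • (latticeBasis Γ).coord i)
  have hl : ∀ z, l z = -∑ i, (n i : ℝ) * (latticeBasis Γ).repr z i := fun z => by simp [l]
  refine ⟨l, fun γ hγ => ?_, fun z => ?_⟩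
  · refine ⟨-∑ i, n i * (Module.Free.chooseBasis ℤ Γ).repr ⟨γ, hγ⟩ i, ?_⟩
    have hcoord := (Module.Free.chooseBasis ℤ Γ).ofZLatticeBasis_repr_apply ℝ Γ ⟨γ, hγ⟩
    push_cast
    rw [hl]
    congr! 3 with i
    exact hcoord i
  · rw [linChar, hl]
    simp only [UnitAddTorus.mFourier, ContinuousMap.coe_mk, torusMap, fourier_coe_apply]
    rw [← Complex.exp_sum]
    push_cast
    rw [← Finset.sum_neg_distrib, Finset.mul_sum, Finset.sum_mul]
    congr! 2 with i
    ring

theorem exists_continuousMap_torusMap_eq {p : V → ℂ} (hp : Continuous p)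
    (hper : ∀ (γ : Γ) z, p (γ + z) = p z) :
    ∃ q : C(UnitAddTorus (Module.Free.ChooseBasisIndex ℤ Γ), ℂ), ∀ z, q (torusMap Γ z) = p z := by
  have hquot := isOpenQuotientMap_torusMap (Γ := Γ)
  have hlift : ∀ z, p (Function.surjInv hquot.surjective (torusMap Γ z)) = p z := fun z => by
    obtain ⟨γ, hγ⟩ := exists_lattice_of_torusMap_eq
      (Function.surjInv_eq hquot.surjective (torusMap Γ z)).symm
    rw [hγ, hper]
  refine ⟨⟨fun t => p (Function.surjInv hquot.surjective t), ?_⟩, hlift⟩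
  exact hquot.isQuotientMap.continuous_iff.2 (hp.congr fun z => (hlift z).symm)

variable [MeasurableSpace V] [BorelSpace V] {μ : Measure V}

theorem integrable_mul_torusMap {H : V → ℂ} (hH : Integrable H μ)
    (p : C(UnitAddTorus (Module.Free.ChooseBasisIndex ℤ Γ), ℂ)) :
    Integrable (fun z => H z * p (torusMap Γ z)) μ :=
  hH.mul_bdd (c := ‖p‖)
    (p.continuous.comp isOpenQuotientMap_torusMap.continuous).aestronglyMeasurable
    (Eventually.of_forall fun _ => p.norm_coe_le_norm _)

/-- The integrable function `H` as a functional on the continuous functions on the torus. -/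
noncomputable def torusFunctional (Γ : Submodule ℤ V) [DiscreteTopology Γ] [IsZLattice ℝ Γ]
    {H : V → ℂ} (hH : Integrable H μ) :
    C(UnitAddTorus (Module.Free.ChooseBasisIndex ℤ Γ), ℂ) →L[ℂ] ℂ :=
  LinearMap.mkContinuous
    { toFun := fun p => ∫ z, H z * p (torusMap Γ z) ∂μ
      map_add' := fun p q => by
        simp only [ContinuousMap.add_apply, mul_add]
        exact integral_add (integrable_mul_torusMap hH p) (integrable_mul_torusMap hH q)
      map_smul' := fun c p => by
        simp only [ContinuousMap.smul_apply, smul_eq_mul, RingHom.id_apply, mul_left_comm _ c,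
          integral_const_mul] }
    (∫ z, ‖H z‖ ∂μ) fun p => by
      rw [← integral_mul_const]
      refine norm_integral_le_of_norm_le (hH.norm.mul_const _) (Eventually.of_forall fun z => ?_)
      rw [norm_mul]
      gcongr
      exact p.norm_coe_le_norm _

theorem integral_mul_torusMap_eq_zero {H : V → ℂ} (hH : Integrable H μ)
    (h : ∀ l : V →L[ℝ] ℝ, IsIntegralOn Γ l → ∫ z, H z * linChar l z ∂μ = 0)
    (p : C(UnitAddTorus (Module.Free.ChooseBasisIndex ℤ Γ), ℂ)) :
    ∫ z, H z * p (torusMap Γ z) ∂μ = 0 := by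
  suffices hker : (Submodule.span ℂ (Set.range <| UnitAddTorus.mFourier
      (d := Module.Free.ChooseBasisIndex ℤ Γ))).topologicalClosure
      ≤ (torusFunctional Γ hH).ker by
    rw [UnitAddTorus.span_mFourier_closure_eq_top] at hker
    exact hker (Submodule.mem_top (x := p))
  refine Submodule.topologicalClosure_minimal _ (Submodule.span_le.2 ?_)
    (torusFunctional Γ hH).isClosed_ker
  rintro _ ⟨n, rfl⟩
  obtain ⟨l, hl, he⟩ := exists_mFourier_torusMap_eq_linChar n
  refine Eq.trans ?_ (h l hl)
  exact integral_congr_ae (Eventually.of_forall fun z => by simp only [he])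

end Torus

section Periodization

variable {V : Type*} [NormedAddCommGroup V]

/-- The sum of the translates of `H` by the lattice `Γ`. -/
noncomputable def periodization (Γ : Submodule ℤ V) (H : V → ℂ) (z : V) : ℂ :=
  ∑' γ : Γ, H (γ + z)

variable {Γ : Submodule ℤ V}

theorem periodization_add_of_mem (H : V → ℂ) (γ : Γ) (z : V) :
    periodization Γ H (γ + z) = periodization Γ H z := by
  rw [periodization, periodization, ← (Equiv.addRight γ).tsum_eq fun γ' : Γ => H (γ' + z)]
  simp [add_assoc]

variable [NormedSpace ℝ V] [FiniteDimensional ℝ V] [DiscreteTopology Γ]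

theorem continuous_periodization {φ : V → ℂ} (hφ : Continuous φ) (hs : HasCompactSupport φ) :
    Continuous (periodization Γ φ) := by
  have hfin : ∀ z : V, ∀ r, {γ : Γ | ∃ w ∈ Metric.closedBall z r, φ (γ + w) ≠ 0}.Finite := by
    intro z r
    refine (finite_lattice_inter_of_isBounded Γ
      (hs.isCompact.isBounded.sub (Metric.isBounded_closedBall (x := z) (r := r)))).subset ?_
    rintro γ ⟨w, hw, hγ⟩
    exact ⟨γ + w, subset_tsupport φ hγ, w, hw, add_sub_cancel_right _ _⟩
  have hsum : periodization Γ φ = fun z => ∑ᶠ γ : Γ, φ (γ + z) := funext fun z =>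
    tsum_eq_finsum ((hfin z 0).subset fun γ hγ => ⟨z, Metric.mem_closedBall_self le_rfl, hγ⟩)
  rw [hsum]
  refine continuous_finsum (fun γ => by fun_prop) fun z => ?_
  refine ⟨Metric.closedBall z 1, Metric.closedBall_mem_nhds z one_pos, (hfin z 1).subset ?_⟩
  rintro γ ⟨w, hw, hwz⟩
  exact ⟨w, hwz, hw⟩

variable [IsZLattice ℝ Γ]

theorem exists_finset_subset_iUnion_vadd_latticeDomain {A : Set V} (hA : Bornology.IsBounded A) :
    ∃ F : Finset Γ, A ⊆ ⋃ δ : F, ((δ : Γ) : V) +ᵥ latticeDomain Γ := by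
  have hfin := finite_lattice_inter_of_isBounded Γ (hA.sub (isBounded_latticeDomain Γ))
  refine ⟨hfin.toFinset, fun z hz => ?_⟩
  obtain ⟨γ, hγ, -⟩ := existsUnique_add_mem_latticeDomain Γ z
  refine Set.mem_iUnion.2 ⟨⟨-γ, hfin.mem_toFinset.2 ⟨z, hz, γ + z, hγ, ?_⟩⟩, γ + z, hγ, ?_⟩
  · simp
  · simp

theorem hasSum_indicator_latticeDomain_linChar {l : V →L[ℝ] ℝ} (hl : IsIntegralOn Γ l) (z : V) :
    HasSum (fun γ : Γ => (latticeDomain Γ).indicator (linChar l) (γ + z)) (linChar l z) := by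
  obtain ⟨γ₀, hmem, huniq⟩ := existsUnique_add_mem_latticeDomain Γ z
  convert hasSum_single (f := fun γ : Γ => (latticeDomain Γ).indicator (linChar l) (γ + z)) γ₀
    fun γ hγ => Set.indicator_of_notMem (fun hm => hγ (huniq γ hm)) _
  rw [Set.indicator_of_mem hmem, linChar_add_of_mem hl γ₀.2]

variable [MeasurableSpace V] [BorelSpace V] {μ : Measure V} [μ.IsAddHaarMeasure]

theorem lintegral_eq_tsum_latticeDomain (f : V → ℝ≥0∞) :
    ∫⁻ z, f z ∂μ = ∑' γ : Γ, ∫⁻ z in latticeDomain Γ, f (γ + z) ∂μ :=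
  (isAddFundamentalDomain_latticeDomain Γ μ).lintegral_eq_tsum'' f

theorem setIntegral_linChar_latticeDomain {l : V →L[ℝ] ℝ} (hl : IsIntegralOn Γ l) (hl0 : l ≠ 0) :
    ∫ z in latticeDomain Γ, linChar l z ∂μ = 0 := by
  obtain ⟨a, ha⟩ := exists_linChar_eq_neg_one hl0
  have hD := isAddFundamentalDomain_latticeDomain Γ μ
  refine self_eq_neg.1 ?_
  calc ∫ z in latticeDomain Γ, linChar l z ∂μ
      = ∫ z in a +ᵥ latticeDomain Γ, linChar l z ∂μ :=
        hD.setIntegral_eq (hD.vadd_of_comm a) fun γ z => linChar_add_of_mem hl γ.2 z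
    _ = ∫ z in latticeDomain Γ, linChar l (a + z) ∂μ :=
        (measurePreserving_add_left μ a).setIntegral_image_emb (measurableEmbedding_addLeft a) _ _
    _ = -∫ z in latticeDomain Γ, linChar l z ∂μ := by
        simp_rw [linChar_add, ha, neg_one_mul, integral_neg]

theorem tsum_setLIntegral_add_ne_top {f : V → ℝ≥0∞} (hf : ∫⁻ z, f z ∂μ ≠ ∞) {A : Set V}
    (hA : Bornology.IsBounded A) : ∑' γ : Γ, ∫⁻ z in A, f (γ + z) ∂μ ≠ ∞ := by
  obtain ⟨F, hF⟩ := exists_finset_subset_iUnion_vadd_latticeDomain (Γ := Γ) hA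
  have hD := isAddFundamentalDomain_latticeDomain Γ μ
  have hle : ∑' γ : Γ, ∫⁻ z in A, f (γ + z) ∂μ ≤ F.card * ∫⁻ z, f z ∂μ := calc
    ∑' γ : Γ, ∫⁻ z in A, f (γ + z) ∂μ
      ≤ ∑' γ : Γ, ∑' δ : F, ∫⁻ z in ((δ : Γ) : V) +ᵥ latticeDomain Γ, f (γ + z) ∂μ :=
        ENNReal.tsum_le_tsum fun γ => (lintegral_mono_set hF).trans (lintegral_iUnion_le _ _)
    _ = ∑' δ : F, ∑' γ : Γ, ∫⁻ z in ((δ : Γ) : V) +ᵥ latticeDomain Γ, f (γ + z) ∂μ :=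
        ENNReal.tsum_comm
    _ = ∑' _ : F, ∫⁻ z, f z ∂μ :=
        tsum_congr fun δ => ((hD.vadd_of_comm ((δ : Γ) : V)).lintegral_eq_tsum'' f).symm
    _ = F.card * ∫⁻ z, f z ∂μ := by simp
  exact ne_top_of_le_ne_top (ENNReal.mul_ne_top (ENNReal.natCast_ne_top _) hf) hle

section Integrable

variable {H : V → ℂ} (hH : Integrable H μ)
include hH

theorem ae_summable_periodization : ∀ᵐ z ∂μ, Summable fun γ : Γ => H (γ + z) := by
  have hball : ∀ n : ℕ, ∀ᵐ z ∂μ, z ∈ Metric.closedBall (0 : V) n →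
      Summable fun γ : Γ => ‖H (γ + z)‖ := fun n =>
    (ae_restrict_iff' Metric.isClosed_closedBall.measurableSet).1
      (ae_summable_of_tsum_lintegral_ne_top
        (fun γ => (aestronglyMeasurable_comp_add_left hH.1 (γ : V)).restrict)
        (tsum_setLIntegral_add_ne_top hH.2.ne Metric.isBounded_closedBall))
  filter_upwards [ae_all_iff.2 hball] with z hz
  obtain ⟨n, hn⟩ := exists_nat_ge ‖z‖
  exact (hz n (mem_closedBall_zero_iff.2 hn)).of_norm

theorem locallyIntegrable_periodization : LocallyIntegrable (periodization Γ H) μ :=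
  locallyIntegrable_iff.2 fun _ hK =>
    integrable_tsum (fun γ => (aestronglyMeasurable_comp_add_left hH.1 (γ : V)).restrict)
      (tsum_setLIntegral_add_ne_top hH.2.ne hK.isBounded)

theorem tsum_lintegral_mul_add_ne_top {g : V → ℂ} {C : ℝ≥0} (hC : ∀ z, ‖g z‖₊ ≤ C) {A : Set V}
    (hA : Bornology.IsBounded A) (hAm : MeasurableSet A) (hgA : Function.support g ⊆ A) :
    ∑' γ : Γ, ∫⁻ z, ‖g z * H (γ + z)‖ₑ ∂μ ≠ ∞ := by
  refine ne_top_of_le_ne_top (ENNReal.mul_ne_top (ENNReal.coe_ne_top (r := C))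
    (tsum_setLIntegral_add_ne_top (Γ := Γ) hH.2.ne hA)) ?_
  rw [← ENNReal.tsum_mul_left]
  refine ENNReal.tsum_le_tsum fun γ => ?_
  rw [← lintegral_const_mul' _ _ ENNReal.coe_ne_top, ← lintegral_indicator hAm]
  refine lintegral_mono fun z => ?_
  by_cases hz : z ∈ A
  · rw [Set.indicator_of_mem hz, enorm_mul]
    gcongr
    exact ENNReal.coe_le_coe.2 (hC z)
  · simp [Function.notMem_support.1 fun h => hz (hgA h)]

theorem integral_mul_periodization {g : V → ℂ} (hg : AEStronglyMeasurable g μ) {C : ℝ≥0}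
    (hC : ∀ z, ‖g z‖₊ ≤ C) {A : Set V} (hA : Bornology.IsBounded A) (hAm : MeasurableSet A)
    (hgA : Function.support g ⊆ A) :
    ∫ z, g z * periodization Γ H z ∂μ = ∫ z, H z * periodization Γ g z ∂μ := by
  have hmeas : ∀ γ : Γ, AEStronglyMeasurable (fun z => g z * H (γ + z)) μ := fun γ =>
    hg.mul (aestronglyMeasurable_comp_add_left hH.1 (γ : V))
  have hmeas' : ∀ γ : Γ, AEStronglyMeasurable (fun z => H z * g (γ + z)) μ := fun γ =>
    hH.1.mul (aestronglyMeasurable_comp_add_left hg (γ : V))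
  have hfin := tsum_lintegral_mul_add_ne_top (Γ := Γ) hH hC hA hAm hgA
  have hswap : ∀ (γ : Γ) z, g (γ + z) * H (((-γ : Γ) : V) + (γ + z)) = H z * g (γ + z) :=
    fun γ z => by simp [mul_comm]
  have hfin' : ∑' γ : Γ, ∫⁻ z, ‖H z * g (γ + z)‖ₑ ∂μ ≠ ∞ := by
    rw [← (Equiv.neg Γ).tsum_eq] at hfin
    convert hfin using 3 with γ
    rw [Equiv.neg_apply,
      ← lintegral_add_left_eq_self (fun z => ‖g z * H (((-γ : Γ) : V) + z)‖ₑ) (γ : V)]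
    simp only [hswap]
  calc ∫ z, g z * periodization Γ H z ∂μ = ∑' γ : Γ, ∫ z, g z * H (γ + z) ∂μ := by
        simp_rw [periodization, ← tsum_mul_left]
        exact integral_tsum hmeas hfin
    _ = ∑' γ : Γ, ∫ z, H z * g (γ + z) ∂μ := by
        rw [← (Equiv.neg Γ).tsum_eq]
        refine tsum_congr fun γ => ?_
        rw [Equiv.neg_apply,
          ← integral_add_left_eq_self (fun z => g z * H (((-γ : Γ) : V) + z)) (γ : V)]
        simp only [hswap]
    _ = ∫ z, H z * periodization Γ g z ∂μ := by
        simp_rw [periodization, ← tsum_mul_left]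
        exact (integral_tsum hmeas' hfin').symm

theorem integral_mul_linChar_eq_setIntegral {l : V →L[ℝ] ℝ} (hl : IsIntegralOn Γ l) :
    ∫ z, H z * linChar l z ∂μ = ∫ z in latticeDomain Γ, linChar l z * periodization Γ H z ∂μ := by
  have hDm := measurableSet_latticeDomain Γ
  have hper : periodization Γ ((latticeDomain Γ).indicator (linChar l)) = linChar l :=
    funext fun z => (hasSum_indicator_latticeDomain_linChar hl z).tsum_eq
  rw [← integral_indicator hDm, ← hper, ← integral_mul_periodization hH (C := 1)
    ((continuous_linChar l).aestronglyMeasurable.indicator hDm) (fun z => ?_)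
    (isBounded_latticeDomain Γ) hDm Set.support_indicator_subset, hper]
  · simp_rw [Set.indicator_mul_left]
  · exact (norm_indicator_le_norm_self _ z).trans (norm_linChar l z).le

theorem ae_periodization_eq_zero
    (h : ∀ l : V →L[ℝ] ℝ, IsIntegralOn Γ l → ∫ z, H z * linChar l z ∂μ = 0) :
    ∀ᵐ z ∂μ, periodization Γ H z = 0 := by
  refine ae_eq_zero_of_integral_contDiff_smul_eq_zero (locallyIntegrable_periodization hH) ?_
  intro φ hφ hs
  set ψ : V → ℂ := fun z => (φ z : ℂ)
  have hψ : Continuous ψ := Complex.continuous_ofReal.comp hφ.continuous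
  have hψs : HasCompactSupport ψ := hs.comp_left (g := fun t : ℝ => (t : ℂ)) (by simp)
  obtain ⟨C, hC⟩ := hψs.exists_bound_of_continuous hψ
  obtain ⟨q, hq⟩ := exists_continuousMap_torusMap_eq (Γ := Γ) (continuous_periodization hψ hψs)
    (periodization_add_of_mem ψ)
  calc ∫ z, φ z • periodization Γ H z ∂μ = ∫ z, ψ z * periodization Γ H z ∂μ := by
        simp_rw [Complex.real_smul, ψ]
    _ = ∫ z, H z * periodization Γ ψ z ∂μ :=
        integral_mul_periodization hH hψ.aestronglyMeasurable
          (fun z => NNReal.coe_le_coe.1 ((hC z).trans (Real.le_coe_toNNReal C)))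
          hψs.isCompact.isBounded (isClosed_tsupport ψ).measurableSet (subset_tsupport ψ)
    _ = 0 := by simpa only [hq] using integral_mul_torusMap_eq_zero hH h q

theorem ae_periodization_eq_const_of_integral {κ : ℂ}
    (hzero : ∫ z, H z ∂μ = κ * ZLattice.covolume Γ μ)
    (h : ∀ l : V →L[ℝ] ℝ, IsIntegralOn Γ l → l ≠ 0 → ∫ z, H z * linChar l z ∂μ = 0) :
    ∀ᵐ z ∂μ, periodization Γ H z = κ := by
  have hDm := measurableSet_latticeDomain Γ
  set E := (latticeDomain Γ).indicator (linChar (0 : V →L[ℝ] ℝ))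
  have hE : Integrable E μ := (integrable_indicator_iff hDm).2
    ((integrableOn_const (measure_latticeDomain_ne_top Γ μ)).congr_fun
      (fun z _ => (linChar_zero_left z).symm) hDm)
  have hEl : ∀ l : V →L[ℝ] ℝ,
      ∫ z, E z * linChar l z ∂μ = ∫ z in latticeDomain Γ, linChar l z ∂μ := fun l => by
    rw [← integral_indicator hDm]
    simp only [E, ← Set.indicator_mul_left, linChar_zero_left, one_mul]
  have hzero := ae_periodization_eq_zero (Γ := Γ) (hH.sub (hE.const_mul κ)) fun l hl => by
    simp only [Pi.sub_apply, sub_mul, mul_assoc]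
    rw [integral_sub (integrable_mul_linChar hH l) ((integrable_mul_linChar hE l).const_mul κ),
      integral_const_mul, hEl]
    rcases eq_or_ne l 0 with rfl | hl0
    · simp [hzero, measureReal_latticeDomain]
    · rw [h l hl hl0, setIntegral_linChar_latticeDomain hl hl0, mul_zero, sub_zero]
  filter_upwards [hzero, ae_summable_periodization (Γ := Γ) hH] with z hz hsum
  have hEsum := hasSum_indicator_latticeDomain_linChar (Γ := Γ) isIntegralOn_zero z
  have hdiff := (hsum.hasSum.sub (hEsum.mul_left κ)).tsum_eq
  rw [linChar_zero_left, mul_one] at hdiff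
  exact sub_eq_zero.1 (hdiff.symm.trans hz)

/-- `H` and its periodization have the same Fourier coefficients on the dual lattice. -/
theorem ae_periodization_eq_const_iff {κ : ℂ} :
    (∀ᵐ z ∂μ, periodization Γ H z = κ) ↔ ∫ z, H z ∂μ = κ * ZLattice.covolume Γ μ ∧
      ∀ l : V →L[ℝ] ℝ, IsIntegralOn Γ l → l ≠ 0 → ∫ z, H z * linChar l z ∂μ = 0 := by
  refine ⟨fun h => ?_, fun h => ae_periodization_eq_const_of_integral hH h.1 h.2⟩
  have hcoeff : ∀ l : V →L[ℝ] ℝ, IsIntegralOn Γ l →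
      ∫ z, H z * linChar l z ∂μ = κ * ∫ z in latticeDomain Γ, linChar l z ∂μ := fun l hl => by
    rw [integral_mul_linChar_eq_setIntegral hH hl, ← integral_const_mul]
    refine integral_congr_ae (ae_restrict_of_ae (h.mono fun z hz => ?_))
    simp only [hz, mul_comm]
  refine ⟨?_, fun l hl hl0 => ?_⟩
  · simpa [measureReal_latticeDomain] using hcoeff 0 isIntegralOn_zero
  · rw [hcoeff l hl, setIntegral_linChar_latticeDomain hl hl0, mul_zero]

end Integrable

end Periodization

section BesselFamily

variable {ι H : Type*} [NormedAddCommGroup H] [InnerProductSpace ℂ H] {e e' : ι → H}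

/-- The coefficient sequence of `f` with respect to a Bessel family, in `ℓ²`. -/
noncomputable def besselCoeff (he : IsBessel e) (f : H) : lp (fun _ : ι => ℂ) 2 :=
  ⟨fun i => ⟪e i, f⟫_ℂ, memℓp_gen (by simpa using (he.choose_spec.2 f).1)⟩

theorem besselCoeff_apply (he : IsBessel e) (f : H) (i : ι) : besselCoeff he f i = ⟪e i, f⟫_ℂ :=
  rfl

theorem exists_norm_besselCoeff_le (he : IsBessel e) :
    ∃ C, ∀ f, ‖besselCoeff he f‖ ≤ C * ‖f‖ := by
  obtain ⟨B, hB, h⟩ := id he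
  refine ⟨Real.sqrt B, fun f => ?_⟩
  have hnorm := lp.norm_rpow_eq_tsum (p := 2) (by norm_num) (besselCoeff he f)
  simp only [ENNReal.toReal_ofNat, Real.rpow_ofNat, besselCoeff_apply] at hnorm
  rw [← Real.sqrt_sq (norm_nonneg f), ← Real.sqrt_mul hB.le]
  exact Real.le_sqrt_of_sq_le (hnorm.trans_le (h f).2)

/-- The analysis operator of a Bessel family. -/
noncomputable def analysis (he : IsBessel e) : H →L[ℂ] lp (fun _ : ι => ℂ) 2 :=
  LinearMap.mkContinuousOfExistsBound
    { toFun := besselCoeff he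
      map_add' := fun f g => by ext i; simp [besselCoeff_apply]
      map_smul' := fun c f => by ext i; simp [besselCoeff_apply] }
    (exists_norm_besselCoeff_le he)

theorem analysis_apply (he : IsBessel e) (f : H) (i : ι) : analysis he f i = ⟪e i, f⟫_ℂ := rfl

theorem hasSum_inner_analysis (he : IsBessel e) (he' : IsBessel e') (f₁ f₂ : H) :
    HasSum (fun i => ⟪f₂, e' i⟫_ℂ * ⟪e i, f₁⟫_ℂ) ⟪analysis he' f₂, analysis he f₁⟫_ℂ := by
  refine (lp.hasSum_inner (𝕜 := ℂ) (analysis he' f₂) (analysis he f₁)).congr_fun fun i => ?_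
  rw [analysis_apply, analysis_apply, RCLike.inner_apply, inner_conj_symm, mul_comm]

theorem hasSum_inner_smul [CompleteSpace H] (he : IsBessel e) (he' : IsBessel e') (f : H) :
    HasSum (fun i => ⟪e i, f⟫_ℂ • e' i)
      (ContinuousLinearMap.adjoint (analysis he') (analysis he f)) := by
  classical
  convert (lp.hasSum_single (by norm_num) (analysis he f)).mapL
    (ContinuousLinearMap.adjoint (analysis he')) using 1
  funext i
  refine ext_inner_left ℂ fun v => ?_
  rw [ContinuousLinearMap.adjoint_inner_right, lp.inner_single_right, analysis_apply,
    analysis_apply, RCLike.inner_apply, inner_conj_symm, inner_smul_right]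

theorem isDualSystem_iff [CompleteSpace H] (he : IsBessel e) (he' : IsBessel e') {D : Set H}
    (hD : Dense D) :
    IsDualSystem e' e ↔
      ∀ f₁ ∈ D, ∀ f₂ ∈ D, ∑' i, ⟪f₂, e' i⟫_ℂ * ⟪e i, f₁⟫_ℂ = ⟪f₂, f₁⟫_ℂ := by
  set S : H →L[ℂ] H := (ContinuousLinearMap.adjoint (analysis he')).comp (analysis he)
  have hS (f : H) : HasSum (fun i => ⟪e i, f⟫_ℂ • e' i) (S f) := hasSum_inner_smul he he' f
  have hform (f₁ f₂ : H) : ∑' i, ⟪f₂, e' i⟫_ℂ * ⟪e i, f₁⟫_ℂ = ⟪f₂, S f₁⟫_ℂ :=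
    (hasSum_inner_analysis he he' f₁ f₂).tsum_eq.trans
      (ContinuousLinearMap.adjoint_inner_right _ _ _).symm
  simp_rw [hform]
  constructor
  · intro h f₁ _ f₂ _
    rw [(hS f₁).unique (h f₁)]
  · intro h f
    have hSD : Set.EqOn S id D := fun f₁ hf₁ =>
      hD.eq_of_inner_right (𝕜 := ℂ) fun f₂ hf₂ => h f₁ hf₁ f₂ hf₂
    have hSid : ⇑S = id := S.continuous.ext_on hD continuous_id hSD
    simpa only [hSid, id] using hS f

theorem continuous_tsum_inner (he : IsBessel e) (he' : IsBessel e') {X : Type*}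
    [TopologicalSpace X] {f₁ f₂ : X → H} (h₁ : Continuous f₁) (h₂ : Continuous f₂) :
    Continuous fun x => ∑' i, ⟪f₂ x, e' i⟫_ℂ * ⟪e i, f₁ x⟫_ℂ := by
  simp_rw [fun x => (hasSum_inner_analysis he he' (f₁ x) (f₂ x)).tsum_eq]
  exact ((analysis he').continuous.comp h₂).inner ((analysis he).continuous.comp h₁)

theorem isBessel_iff_tsum_enorm :
    IsBessel e ↔ ∃ B : ℝ≥0, ∀ f : H, ∑' i, ‖⟪e i, f⟫_ℂ‖ₑ ^ 2 ≤ B * ‖f‖ₑ ^ 2 := by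
  have henorm (x : ℂ) : ‖x‖ₑ ^ 2 = ENNReal.ofReal (‖x‖ ^ 2) := by
    rw [ENNReal.ofReal_pow (norm_nonneg _), ofReal_norm]
  simp_rw [henorm]
  constructor
  · rintro ⟨B, hB, h⟩
    refine ⟨B.toNNReal, fun f => ?_⟩
    rw [← ENNReal.ofReal_tsum_of_nonneg (fun _ => by positivity) (h f).1, ← ofReal_norm,
      ← ENNReal.ofReal_pow (norm_nonneg _), ENNReal.ofNNReal_toNNReal,
      ← ENNReal.ofReal_mul hB.le]
    exact ENNReal.ofReal_le_ofReal (h f).2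
  · rintro ⟨B, h⟩
    refine ⟨B + 1, by positivity, fun f => ?_⟩
    have hsum : Summable fun i => ‖⟪e i, f⟫_ℂ‖ ^ 2 :=
      (ENNReal.summable_toReal (ne_top_of_le_ne_top (by finiteness) (h f))).congr fun i =>
        ENNReal.toReal_ofReal (by positivity)
    refine ⟨hsum, ?_⟩
    have hle := h f
    rw [← ENNReal.ofReal_tsum_of_nonneg (fun _ => by positivity) hsum, ← ofReal_norm,
      ← ENNReal.ofReal_pow (norm_nonneg _), ← ENNReal.ofReal_coe_nnreal,
      ← ENNReal.ofReal_mul B.coe_nonneg, ENNReal.ofReal_le_ofReal_iff (by positivity)] at hle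
    exact hle.trans (by gcongr; linarith)

end BesselFamily

section Translation

variable {m : ℕ}

/-- Translation by `x` on `L²(ℝᵐ)`. -/
noncomputable def transL2 (x : Rm m) : L2 m →ₗᵢ[ℂ] L2 m :=
  Lp.compMeasurePreservingₗᵢ ℂ (fun t => t - x) (measurePreserving_sub_right volume x)

theorem coeFn_transL2 (x : Rm m) (f : L2 m) : transL2 x f =ᵐ[volume] fun t => f (t - x) :=
  Lp.coeFn_compMeasurePreserving f (measurePreserving_sub_right volume x)

theorem transL2_add (x y : Rm m) (f : L2 m) : transL2 (x + y) f = transL2 x (transL2 y f) := by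
  apply Lp.ext
  have hcomp := (measurePreserving_sub_right volume x).quasiMeasurePreserving.ae_eq_comp
    (coeFn_transL2 y f)
  filter_upwards [coeFn_transL2 (x + y) f, coeFn_transL2 x (transL2 y f), hcomp] with t h₁ h₂ h₃
  rw [h₁, h₂, ← sub_sub]
  exact h₃.symm

@[simp]
theorem transL2_zero (f : L2 m) : transL2 0 f = f := by
  apply Lp.ext
  filter_upwards [coeFn_transL2 0 f] with t ht
  rw [ht, sub_zero]

theorem inner_transL2 (x : Rm m) (f g : L2 m) : ⟪transL2 x f, g⟫_ℂ = ⟪f, transL2 (-x) g⟫_ℂ := by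
  rw [← (transL2 (-x)).inner_map_map, ← transL2_add, neg_add_cancel, transL2_zero]

theorem inner_transL2_right (x : Rm m) (f g : L2 m) :
    ⟪f, transL2 x g⟫_ℂ = ⟪transL2 (-x) f, g⟫_ℂ := by
  rw [inner_transL2, neg_neg]

theorem enorm_transL2 (x : Rm m) (f : L2 m) : ‖transL2 x f‖ₑ = ‖f‖ₑ := by
  rw [← ofReal_norm, ← ofReal_norm, LinearIsometry.norm_map]

theorem continuous_transL2_neg (f : L2 m) : Continuous fun x : Rm m => transL2 (-x) f := by
  let c (x : Rm m) : C(Rm m, Rm m) := ⟨fun t => t - -x, by fun_prop⟩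
  have hc : Continuous c := ContinuousMap.continuous_of_continuous_uncurry _ (by
    simp only [Function.uncurry_def, c, ContinuousMap.coe_mk]; fun_prop)
  exact (continuous_const (y := f)).compMeasurePreservingLp hc
    (fun x => measurePreserving_sub_right volume (-x)) (by norm_num)

theorem memLp_modulate (ω : Rm m) (f : L2 m) :
    MemLp (modulate ω f) 2 (volume : Measure (Rm m)) := by
  have h := memLp_translate_modulate 0 ω f
  have hzero : translate 0 (modulate ω (f : Rm m → ℂ)) = modulate ω f :=
    funext fun t => by simp [translate]
  rwa [hzero] at h

/-- The modulation `M_ω f` on `L²(ℝᵐ)`. -/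
noncomputable def modL2 (ω : Rm m) (f : L2 m) : L2 m := (memLp_modulate ω f).toLp

end Translation

section ModelSystem

variable {m : ℕ} {J : Type*}

/-- The family of translates of `u` along `Λ`. -/
noncomputable def modelSystem (u : J → L2 m) (Λ : Set (Rm m)) : J × Λ → L2 m :=
  fun i => transL2 (i.2 : Rm m) (u i.1)

/-- The sum of the squares of the coefficients of `f` with respect to `u`. -/
noncomputable def energy (u : J → L2 m) (f : L2 m) : ℝ≥0∞ := ∑' j, ‖⟪u j, f⟫_ℂ‖ₑ ^ 2

theorem measurable_energy_transL2 [Countable J] (u : J → L2 m) (f : L2 m) :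
    Measurable fun x : Rm m => energy u (transL2 (-x) f) :=
  Measurable.tsum fun _ =>
    (continuous_const.inner (continuous_transL2_neg f)).enorm.measurable.pow_const 2

/-- The sum of the squares of the coefficients of `f` with respect to the translates of `u` by the
lattice points over the window `W`. -/
noncomputable def latticeEnergy (Γ : Submodule ℤ (Rm m × ℝ)) (u : J → L2 m) (W : Set ℝ)
    (f : L2 m) : ℝ≥0∞ :=
  ∑' γ : Γ, (Prod.snd ⁻¹' W).indicator (fun z => energy u (transL2 (-z.1) f)) (γ : Rm m × ℝ)

/-- Every bounded window turns `u` into a Bessel sequence of translates; see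
`isBessel_modelSystem_iff`. -/
def IsLatticeBessel (Γ : Submodule ℤ (Rm m × ℝ)) (u : J → L2 m) : Prop :=
  ∀ W : Set ℝ, Bornology.IsBounded W →
    ∃ B : ℝ≥0, ∀ f, latticeEnergy Γ u W f ≤ B * ‖f‖ₑ ^ 2

variable {Γ : Submodule ℤ (Rm m × ℝ)}

theorem tsum_modelSet (hinj : Set.InjOn Prod.fst (Γ : Set (Rm m × ℝ))) {M : Type*}
    [AddCommMonoid M] [TopologicalSpace M] (W : Set ℝ) (φ : Rm m → M) :
    ∑' x : modelSet Γ W, φ x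
      = ∑' γ : Γ, (Prod.snd ⁻¹' W).indicator (fun z => φ z.1) (γ : Rm m × ℝ) := by
  have hset : {γ : Rm m × ℝ | γ ∈ Γ ∧ γ.2 ∈ W} = (Γ : Set (Rm m × ℝ)) ∩ Prod.snd ⁻¹' W := rfl
  rw [modelSet, hset, tsum_image φ (hinj.mono Set.inter_subset_left),
    tsum_subtype _ fun z : Rm m × ℝ => φ z.1, ← Set.indicator_indicator, ← tsum_subtype]
  rfl

theorem tsum_enorm_modelSystem (hinj : Set.InjOn Prod.fst (Γ : Set (Rm m × ℝ))) (u : J → L2 m)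
    (W : Set ℝ) (f : L2 m) :
    ∑' i, ‖⟪modelSystem u (modelSet Γ W) i, f⟫_ℂ‖ₑ ^ 2 = latticeEnergy Γ u W f := by
  rw [ENNReal.tsum_prod
    (f := fun j (x : modelSet Γ W) => ‖⟪modelSystem u _ (j, x), f⟫_ℂ‖ₑ ^ 2), ENNReal.tsum_comm]
  simp_rw [modelSystem, inner_transL2]
  exact tsum_modelSet hinj W fun x => energy u (transL2 (-x) f)

section LatticeEnergy

variable (u : J → L2 m) (f : L2 m)

theorem tsum_indicator_energy_add (W : Set ℝ) (z : Rm m × ℝ) :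
    ∑' γ : Γ, (Prod.snd ⁻¹' W).indicator (fun z => energy u (transL2 (-z.1) f)) (γ + z)
      = latticeEnergy Γ u ((· + z.2) ⁻¹' W) (transL2 (-z.1) f) :=
  tsum_congr fun γ => by
    classical
    simp only [Set.indicator_apply, Set.mem_preimage, Prod.fst_add, Prod.snd_add, neg_add,
      transL2_add]

theorem latticeEnergy_preimage_add (W : Set ℝ) (γ : Γ) :
    latticeEnergy Γ u ((· + (γ : Rm m × ℝ).2) ⁻¹' W) f
      = latticeEnergy Γ u W (transL2 (γ : Rm m × ℝ).1 f) := by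
  classical
  refine Eq.trans (tsum_congr fun γ' => ?_) ((Equiv.addRight γ).tsum_eq _)
  simp only [Set.indicator_apply, Set.mem_preimage, Equiv.coe_addRight, Submodule.coe_add,
    Prod.fst_add, Prod.snd_add, ← transL2_add, neg_add, neg_add_cancel_right]

theorem latticeEnergy_mono {W W' : Set ℝ} (h : W ⊆ W') :
    latticeEnergy Γ u W f ≤ latticeEnergy Γ u W' f :=
  ENNReal.tsum_le_tsum fun _ =>
    Set.indicator_le_indicator_of_subset (Set.preimage_mono h) (fun _ => zero_le) _

theorem latticeEnergy_biUnion_le {α : Type*} (s : Finset α) (W : α → Set ℝ) :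
    latticeEnergy Γ u (⋃ i ∈ s, W i) f ≤ ∑ i ∈ s, latticeEnergy Γ u (W i) f := by
  simp_rw [latticeEnergy]
  rw [← Summable.tsum_finsetSum fun _ _ => ENNReal.summable]
  refine ENNReal.tsum_le_tsum fun γ => ?_
  simp_rw [Set.preimage_iUnion]
  refine Set.indicator_apply_le' (fun hγ => ?_) fun _ => zero_le
  obtain ⟨i, hi, hγ⟩ := Set.mem_iUnion₂.1 hγ
  rw [← Set.indicator_of_mem hγ fun z : Rm m × ℝ => energy u (transL2 (-z.1) f)]
  exact Finset.single_le_sum (f := fun i => (Prod.snd ⁻¹' W i).indicator _ (γ : Rm m × ℝ))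
    (fun _ _ => zero_le) hi

end LatticeEnergy

theorem exists_finset_subset_biUnion_preimage
    (hdense : Dense (Prod.snd '' (Γ : Set (Rm m × ℝ)))) {W K : Set ℝ} (hW : (interior W).Nonempty)
    (hK : Bornology.IsBounded K) :
    ∃ t : Finset Γ, K ⊆ ⋃ γ ∈ t, (· + (γ : Rm m × ℝ).2) ⁻¹' W := by
  have hopen (γ : Γ) : IsOpen ((· + (γ : Rm m × ℝ).2) ⁻¹' interior W) :=
    isOpen_interior.preimage (continuous_add_const _)
  have hcover : closure K ⊆ ⋃ γ : Γ, (· + (γ : Rm m × ℝ).2) ⁻¹' interior W := fun s _ => by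
    obtain ⟨w, hw⟩ := hW
    obtain ⟨_, ⟨γ, hγ, rfl⟩, hsγ⟩ := hdense.exists_mem_open
      (isOpen_interior.preimage (continuous_const_add s)) ⟨w - s, by simpa using hw⟩
    exact Set.mem_iUnion.2 ⟨⟨γ, hγ⟩, hsγ⟩
  obtain ⟨t, ht⟩ := hK.isCompact_closure.elim_finite_subcover _ hopen hcover
  exact ⟨t, (subset_closure.trans ht).trans
    (Set.iUnion₂_mono fun γ _ => Set.preimage_mono interior_subset)⟩

theorem IsLatticeBessel.isBessel_modelSystem {u : J → L2 m} (hu : IsLatticeBessel Γ u)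
    (hinj : Set.InjOn Prod.fst (Γ : Set (Rm m × ℝ))) {W : Set ℝ} (hW : Bornology.IsBounded W) :
    IsBessel (modelSystem u (modelSet Γ W)) := by
  simp_rw [isBessel_iff_tsum_enorm, tsum_enorm_modelSystem hinj]
  exact hu W hW

theorem isBessel_modelSystem_iff (hinj : Set.InjOn Prod.fst (Γ : Set (Rm m × ℝ)))
    (hdense : Dense (Prod.snd '' (Γ : Set (Rm m × ℝ)))) {W : Set ℝ}
    (hWb : Bornology.IsBounded W) (hW : (interior W).Nonempty) {u : J → L2 m} :
    IsBessel (modelSystem u (modelSet Γ W)) ↔ IsLatticeBessel Γ u := by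
  refine ⟨fun h K hK => ?_, fun h => h.isBessel_modelSystem hinj hWb⟩
  simp_rw [isBessel_iff_tsum_enorm, tsum_enorm_modelSystem hinj] at h
  obtain ⟨B, hB⟩ := h
  obtain ⟨t, ht⟩ := exists_finset_subset_biUnion_preimage hdense hW hK
  refine ⟨t.card * B, fun f => ?_⟩
  calc latticeEnergy Γ u K f
      ≤ ∑ γ ∈ t, latticeEnergy Γ u ((· + (γ : Rm m × ℝ).2) ⁻¹' W) f :=
        (latticeEnergy_mono u f ht).trans (latticeEnergy_biUnion_le u f t _)
    _ ≤ ∑ γ ∈ t, B * ‖f‖ₑ ^ 2 := Finset.sum_le_sum fun γ _ => by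
        rw [latticeEnergy_preimage_add]
        exact (hB _).trans_eq (by rw [enorm_transL2])
    _ = _ := by
        rw [Finset.sum_const, nsmul_eq_mul]
        push_cast
        ring

theorem IsLatticeBessel.isBessel {u : J → L2 m} (hu : IsLatticeBessel Γ u) : IsBessel u := by
  obtain ⟨B, hB⟩ := hu {0} Bornology.isBounded_singleton
  refine isBessel_iff_tsum_enorm.2 ⟨B, fun f => le_trans ?_ (hB f)⟩
  refine le_trans (le_of_eq ?_) (ENNReal.le_tsum (0 : Γ))
  simp [energy]

theorem IsLatticeBessel.lintegral_energy_ne_top [Countable J] [DiscreteTopology Γ]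
    [IsZLattice ℝ Γ] {u : J → L2 m} (hu : IsLatticeBessel Γ u) (f : L2 m) :
    ∫⁻ x : Rm m, energy u (transL2 (-x) f) ≠ ∞ := by
  obtain ⟨c, -, hc⟩ := exists_latticeDomain_bound (Γ := Γ)
  obtain ⟨B, hB⟩ := hu (Set.Icc (-c) (1 + c)) (Metric.isBounded_Icc _ _)
  set F : Rm m × ℝ → ℝ≥0∞ :=
    (Prod.snd ⁻¹' Set.Icc 0 1).indicator fun z => energy u (transL2 (-z.1) f) with hF
  have henergy : Measurable fun z : Rm m × ℝ => energy u (transL2 (-z.1) f) :=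
    (measurable_energy_transL2 u f).comp measurable_fst
  have hmeas : Measurable F := henergy.indicator (measurable_snd measurableSet_Icc)
  have hprod : ∫⁻ x : Rm m, energy u (transL2 (-x) f) = ∫⁻ z, F z := by
    rw [Measure.volume_eq_prod, lintegral_indicator (measurable_snd measurableSet_Icc),
      ← Set.univ_prod, ← Measure.prod_restrict, Measure.restrict_univ,
      lintegral_prod _ henergy.aemeasurable]
    simp
  have hfiber (z) (hz : z ∈ latticeDomain Γ) : ∑' γ : Γ, F (γ + z) ≤ B * ‖f‖ₑ ^ 2 := by
    have hz2 := abs_le.1 (hc z hz).2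
    rw [hF, tsum_indicator_energy_add, ← enorm_transL2 (-z.1) f]
    refine (latticeEnergy_mono u _ fun s hs => ?_).trans (hB _)
    exact ⟨by linarith [hs.1], by linarith [hs.2]⟩
  have hmeas' (γ : Γ) : AEMeasurable (fun z => F (γ + z)) (volume.restrict (latticeDomain Γ)) :=
    (hmeas.comp (measurable_const_add _)).aemeasurable
  rw [hprod, lintegral_eq_tsum_latticeDomain (Γ := Γ), ← lintegral_tsum hmeas']
  refine ne_top_of_le_ne_top ?_ (setLIntegral_mono measurable_const hfiber)
  rw [setLIntegral_const]
  exact ENNReal.mul_ne_top (by finiteness) (measure_latticeDomain_ne_top Γ volume)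

end ModelSystem

section MixedSum

variable {m : ℕ} {J : Type*} {Γ : Submodule ℤ (Rm m × ℝ)} {u v : J → L2 m}

/-- The mixed coefficient sum `∑ⱼ ⟨T₋ₓ f₁, uⱼ⟩ ⟨vⱼ, T₋ₓ f₂⟩`. -/
noncomputable def mixedSum (u v : J → L2 m) (f₁ f₂ : L2 m) (x : Rm m) : ℂ :=
  ∑' j, ⟪transL2 (-x) f₂, v j⟫_ℂ * ⟪u j, transL2 (-x) f₁⟫_ℂ

theorem mul_le_sq_add_sq (p q : ℝ≥0∞) : p * q ≤ p ^ 2 + q ^ 2 :=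
  calc p * q ≤ max p q ^ 2 := by
        rw [sq]; exact mul_le_mul' (le_max_left p q) (le_max_right p q)
    _ = max (p ^ 2) (q ^ 2) := (pow_left_mono 2).map_max
    _ ≤ p ^ 2 + q ^ 2 := max_le_add_of_nonneg zero_le zero_le

theorem tsum_enorm_mixed_le (u v : J → L2 m) (f₁ f₂ : L2 m) (x : Rm m) :
    ∑' j, ‖⟪transL2 (-x) f₂, v j⟫_ℂ * ⟪u j, transL2 (-x) f₁⟫_ℂ‖ₑ
      ≤ energy u (transL2 (-x) f₁) + energy v (transL2 (-x) f₂) := by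
  rw [energy, energy, ← ENNReal.tsum_add]
  refine ENNReal.tsum_le_tsum fun j => ?_
  rw [enorm_mul, mul_comm, ← inner_conj_symm _ (v j), RCLike.enorm_conj]
  exact mul_le_sq_add_sq _ _

theorem enorm_mixedSum_le (u v : J → L2 m) (f₁ f₂ : L2 m) (x : Rm m) :
    ‖mixedSum u v f₁ f₂ x‖ₑ ≤ energy u (transL2 (-x) f₁) + energy v (transL2 (-x) f₂) :=
  enorm_tsum_le_tsum_enorm.trans (tsum_enorm_mixed_le u v f₁ f₂ x)

theorem continuous_mixed (p q f₁ f₂ : L2 m) :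
    Continuous fun x : Rm m => ⟪transL2 (-x) f₂, q⟫_ℂ * ⟪p, transL2 (-x) f₁⟫_ℂ :=
  ((continuous_transL2_neg f₂).inner continuous_const).mul
    (continuous_const.inner (continuous_transL2_neg f₁))

section Integrability

variable [Countable J] [DiscreteTopology Γ] [IsZLattice ℝ Γ]

theorem tsum_lintegral_mixed_ne_top (hu : IsLatticeBessel Γ u) (hv : IsLatticeBessel Γ v)
    (f₁ f₂ : L2 m) :
    ∑' j, ∫⁻ x, ‖⟪transL2 (-x) f₂, v j⟫_ℂ * ⟪u j, transL2 (-x) f₁⟫_ℂ‖ₑ ≠ ∞ := by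
  rw [← lintegral_tsum fun j => (continuous_mixed _ _ f₁ f₂).enorm.measurable.aemeasurable]
  refine ne_top_of_le_ne_top ?_ (lintegral_mono (tsum_enorm_mixed_le u v f₁ f₂))
  rw [lintegral_add_left (measurable_energy_transL2 u f₁)]
  exact ENNReal.add_ne_top.2 ⟨hu.lintegral_energy_ne_top f₁, hv.lintegral_energy_ne_top f₂⟩

theorem integrable_mixedSum (hu : IsLatticeBessel Γ u) (hv : IsLatticeBessel Γ v)
    (f₁ f₂ : L2 m) : Integrable (mixedSum u v f₁ f₂) :=
  integrable_tsum (fun _ => (continuous_mixed _ _ f₁ f₂).aestronglyMeasurable)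
    (tsum_lintegral_mixed_ne_top hu hv f₁ f₂)

end Integrability

/-- The mixed coefficient sum tensored with the indicator function of the window; its periodization
is the mixed frame form of the translated systems, see `periodization_windowTensor`. -/
noncomputable def windowTensor (u v : J → L2 m) (W : Set ℝ) (f₁ f₂ : L2 m) (z : Rm m × ℝ) : ℂ :=
  mixedSum u v f₁ f₂ z.1 * W.indicator 1 z.2

theorem windowTensor_eq_indicator (u v : J → L2 m) (W : Set ℝ) (f₁ f₂ : L2 m) :
    windowTensor u v W f₁ f₂
      = (Prod.snd ⁻¹' W).indicator fun z : Rm m × ℝ => mixedSum u v f₁ f₂ z.1 := by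
  classical
  ext z
  simp [windowTensor, Set.indicator_apply]

theorem integrable_windowTensor [Countable J] [DiscreteTopology Γ] [IsZLattice ℝ Γ]
    (hu : IsLatticeBessel Γ u) (hv : IsLatticeBessel Γ v) {W : Set ℝ}
    (hW : Bornology.IsBounded W) (hW' : NullMeasurableSet W) (f₁ f₂ : L2 m) :
    Integrable (windowTensor u v W f₁ f₂) := by
  rw [Measure.volume_eq_prod]
  refine (integrable_mixedSum hu hv f₁ f₂).mul_prod ?_
  exact (integrableOn_const hW.measure_lt_top.ne).integrable_indicator₀ hW'

theorem summable_windowTensor (hu : IsLatticeBessel Γ u) (hv : IsLatticeBessel Γ v) {W : Set ℝ}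
    (hW : Bornology.IsBounded W) (f₁ f₂ : L2 m) (x : Rm m) :
    Summable fun γ : Γ => ‖windowTensor u v W f₁ f₂ ((γ : Rm m × ℝ) + (x, 0))‖ := by
  obtain ⟨B, hB⟩ := hu W hW
  obtain ⟨B', hB'⟩ := hv W hW
  rw [← tsum_enorm_ne_top_iff_summable_norm]
  have hfin (B : ℝ≥0) (f : L2 m) : (B : ℝ≥0∞) * ‖f‖ₑ ^ 2 ≠ ∞ := by finiteness
  refine ne_top_of_le_ne_top (ENNReal.add_ne_top.2
    ⟨ne_top_of_le_ne_top (hfin _ _) (hB (transL2 (-x) f₁)),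
      ne_top_of_le_ne_top (hfin _ _) (hB' (transL2 (-x) f₂))⟩) ?_
  rw [latticeEnergy, latticeEnergy, ← ENNReal.tsum_add]
  refine ENNReal.tsum_le_tsum fun γ => ?_
  classical
  simp only [windowTensor_eq_indicator, Set.indicator_apply, Set.mem_preimage, Prod.fst_add,
    Prod.snd_add, add_zero, ← transL2_add, ← neg_add]
  split_ifs
  · exact enorm_mixedSum_le u v f₁ f₂ _
  · simp

theorem periodization_windowTensor (hinj : Set.InjOn Prod.fst (Γ : Set (Rm m × ℝ))) {W : Set ℝ}
    (hu : IsBessel (modelSystem u (modelSet Γ W))) (hv : IsBessel (modelSystem v (modelSet Γ W)))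
    (f₁ f₂ : L2 m) (x : Rm m) :
    periodization Γ (windowTensor u v W f₁ f₂) (x, 0)
      = ∑' i, ⟪transL2 (-x) f₂, modelSystem v (modelSet Γ W) i⟫_ℂ
        * ⟪modelSystem u (modelSet Γ W) i, transL2 (-x) f₁⟫_ℂ := by
  have hsum := (hasSum_inner_analysis hu hv (transL2 (-x) f₁) (transL2 (-x) f₂)).summable
  rw [← (Equiv.prodComm _ _).tsum_eq]
  refine Eq.trans ?_ (Summable.tsum_prod ((Equiv.prodComm _ _).summable_iff.2 hsum)).symm
  simp only [Function.comp_apply, Equiv.prodComm_apply, Prod.swap_prod_mk, modelSystem]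
  simp_rw [inner_transL2_right _ (transL2 (-x) f₂), inner_transL2 _ _ (transL2 (-x) f₁),
    ← transL2_add, ← neg_add]
  rw [tsum_modelSet hinj W fun y => ∑' j,
    ⟪transL2 (-(y + x)) f₂, v j⟫_ℂ * ⟪u j, transL2 (-(y + x)) f₁⟫_ℂ]
  classical
  simp [periodization, windowTensor_eq_indicator, Set.indicator_apply, mixedSum]

theorem continuous_periodization_windowTensor (hinj : Set.InjOn Prod.fst (Γ : Set (Rm m × ℝ)))
    {W : Set ℝ} (hu : IsBessel (modelSystem u (modelSet Γ W)))
    (hv : IsBessel (modelSystem v (modelSet Γ W))) (f₁ f₂ : L2 m) :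
    Continuous fun x => periodization Γ (windowTensor u v W f₁ f₂) (x, 0) := by
  simp_rw [periodization_windowTensor hinj hu hv]
  exact continuous_tsum_inner hu hv (continuous_transL2_neg f₁) (continuous_transL2_neg f₂)

end MixedSum

section Genericity

variable {m : ℕ} {J : Type*} {Γ : Submodule ℤ (Rm m × ℝ)} {u v : J → L2 m} {W : Set ℝ}

theorem continuousAt_periodization_windowTensor (hu : IsLatticeBessel Γ u)
    (hv : IsLatticeBessel Γ v) (hW : Bornology.IsBounded W) (f₁ f₂ : L2 m) (x : Rm m) {y : ℝ}
    (hy : ∀ γ ∈ Γ, γ.2 + y ∉ frontier W) :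
    ContinuousAt (fun y : ℝ => periodization Γ (windowTensor u v W f₁ f₂) (x, y)) y := by
  have hK : Bornology.IsBounded (W - Metric.ball y 1) := hW.sub Metric.isBounded_ball
  refine tendsto_tsum_of_dominated_convergence (summable_windowTensor hu hv hK f₁ f₂ x)
    (fun γ => ?_) ?_
  · have hcont : ContinuousAt (fun s => W.indicator (1 : ℝ → ℂ) ((γ : Rm m × ℝ).2 + s)) y :=
      ContinuousAt.comp (f := fun s => (γ : Rm m × ℝ).2 + s)
        (continuousOn_const.continuousAt_indicator (hy γ γ.2)) (by fun_prop)
    exact continuousAt_const.mul hcont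
  · filter_upwards [Metric.ball_mem_nhds y one_pos] with s hs γ
    classical
    simp only [windowTensor_eq_indicator, Set.indicator_apply, Set.mem_preimage, Prod.fst_add,
      Prod.snd_add]
    split_ifs with hsW hsK
    · rfl
    · exact absurd (by simpa using Set.sub_mem_sub hsW hs) hsK
    · simp
    · simp

theorem ae_forall_add_notMem_frontier [Countable Γ] (hW : volume (frontier W) = 0) :
    ∀ᵐ z : Rm m × ℝ, ∀ γ : Γ, (γ : Rm m × ℝ).2 + z.2 ∉ frontier W := by
  refine ae_all_iff.2 fun γ => ?_
  rw [Measure.volume_eq_prod]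
  exact (quasiMeasurePreserving_add_left volume (γ : Rm m × ℝ).2).comp
    Measure.quasiMeasurePreserving_snd |>.ae (measure_eq_zero_iff_ae_notMem.1 hW)

theorem forall_periodization_windowTensor_eq_iff [Countable Γ]
    (hinj : Set.InjOn Prod.fst (Γ : Set (Rm m × ℝ)))
    (hdense : Dense (Prod.snd '' (Γ : Set (Rm m × ℝ)))) (hW : Bornology.IsBounded W)
    (hW' : volume (frontier W) = 0) (hgen : IsGeneric Γ W) (hu : IsLatticeBessel Γ u)
    (hv : IsLatticeBessel Γ v) (f₁ f₂ : L2 m) (κ : ℂ) :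
    (∀ x : Rm m, periodization Γ (windowTensor u v W f₁ f₂) (x, 0) = κ) ↔
      ∀ᵐ z : Rm m × ℝ, periodization Γ (windowTensor u v W f₁ f₂) z = κ := by
  constructor
  · intro h
    filter_upwards [ae_forall_add_notMem_frontier (Γ := Γ) hW'] with z hz
    have hcont := continuousAt_periodization_windowTensor hu hv hW f₁ f₂ z.1
      fun γ hγ => hz ⟨γ, hγ⟩
    refine tendsto_nhds_unique_of_frequently_eq hcont (tendsto_const_nhds (x := κ)) ?_
    refine (mem_closure_iff_frequently.1 (hdense z.2)).mono ?_
    rintro _ ⟨γ, hγ, rfl⟩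
    have hperiod := periodization_add_of_mem (windowTensor u v W f₁ f₂) ⟨γ, hγ⟩ (z.1 - γ.1, 0)
    rw [h] at hperiod
    rw [← hperiod, show (γ + (z.1 - γ.1, (0 : ℝ)) : Rm m × ℝ) = (z.1, γ.2) by ext1 <;> simp]
  · intro h
    rw [Measure.volume_eq_prod] at h
    have hae : ∀ᵐ x : Rm m, periodization Γ (windowTensor u v W f₁ f₂) (x, 0) = κ := by
      filter_upwards [Measure.ae_ae_of_ae_prod h] with x hx
      have hcont := continuousAt_periodization_windowTensor hu hv hW f₁ f₂ x (y := 0)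
        fun γ hγ => by simpa only [add_zero] using hgen γ hγ
      refine tendsto_nhds_unique_of_frequently_eq hcont (tendsto_const_nhds (x := κ)) ?_
      exact mem_closure_iff_frequently.1 (Measure.dense_of_ae hx 0)
    have hcont := continuous_periodization_windowTensor hinj (hu.isBessel_modelSystem hinj hW)
      (hv.isBessel_modelSystem hinj hW) f₁ f₂
    exact congrFun ((hcont.ae_eq_iff_eq volume continuous_const).1 hae)

end Genericity

section FourierTranslation

variable {V F : Type*} [NormedAddCommGroup V] [InnerProductSpace ℝ V] [FiniteDimensional ℝ V]
  [MeasurableSpace V] [BorelSpace V] [NormedAddCommGroup F]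

section NormedSpace

variable [NormedSpace ℂ F]

theorem fourier_comp_add_right (f : V → F) (x v : V) :
    𝓕 (fun t => f (t + x)) v = Complex.exp ((2 * Real.pi * ⟪x, v⟫_ℝ : ℝ) * Complex.I) • 𝓕 f v := by
  have h := congrFun (VectorFourier.fourierIntegral_comp_add_right Real.fourierChar
    (volume : Measure V) (innerₗ V) f x) v
  simpa [Function.comp_def, Circle.smul_def, Real.fourierChar_apply] using! h

theorem fourierInv_comp_add_right (f : V → F) (ξ x : V) :
    𝓕⁻ (fun v => f (v + ξ)) x
      = Complex.exp ((-2 * Real.pi * ⟪x, ξ⟫_ℝ : ℝ) * Complex.I) • 𝓕⁻ f x := by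
  rw [Real.fourierInv_eq_fourier_neg, Real.fourierInv_eq_fourier_neg, fourier_comp_add_right,
    inner_neg_right, real_inner_comm, mul_neg, neg_mul, neg_mul]

theorem fourier_exp_smul (f : V → F) (ω v : V) :
    𝓕 (fun t => Complex.exp ((2 * Real.pi * ⟪ω, t⟫_ℝ : ℝ) * Complex.I) • f t) v
      = 𝓕 f (v - ω) := by
  rw [Real.fourier_eq', Real.fourier_eq']
  refine integral_congr_ae (Eventually.of_forall fun t => ?_)
  simp only [smul_smul, ← Complex.exp_add, inner_sub_right, real_inner_comm ω t]
  congr 2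
  push_cast
  ring

end NormedSpace

variable [InnerProductSpace ℂ F] [CompleteSpace F] {f g : V → F}

theorem lintegral_enorm_sq_fourierInv (hf : Integrable f) (hf2 : MemLp f 2) :
    ∫⁻ x, ‖𝓕⁻ f x‖ₑ ^ 2 = ∫⁻ v, ‖f v‖ₑ ^ 2 := by
  have heLpNorm (u : V → F) : ∫⁻ x, ‖u x‖ₑ ^ 2 = eLpNorm u 2 volume ^ 2 := by
    simpa using (eLpNorm_nnreal_pow_eq_lintegral (μ := volume) (f := u) (p := 2) (by norm_num)).symm
  simp_rw [Real.fourierInv_eq_fourier_neg]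
  rw [lintegral_neg_eq_self fun x => ‖𝓕 f x‖ₑ ^ 2, heLpNorm, heLpNorm, eLpNorm_fourier hf hf2]

theorem integral_inner_fourierInv (hf : Integrable f) (hf2 : MemLp f 2) (hg : Integrable g)
    (hg2 : MemLp g 2) : ∫ x, ⟪𝓕⁻ f x, 𝓕⁻ g x⟫_ℂ = ∫ v, ⟪f v, g v⟫_ℂ := by
  simp_rw [Real.fourierInv_eq_fourier_neg]
  rw [integral_neg_eq_self fun x => ⟪𝓕 f x, 𝓕 g x⟫_ℂ, integral_inner_fourier hf hf2 hg hg2]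

theorem integral_inner_fourierInv_mul_exp (hf : Integrable f) (hf2 : MemLp f 2)
    (hg : Integrable g) (hg2 : MemLp g 2) (ξ : V) :
    ∫ x, ⟪𝓕⁻ f x, 𝓕⁻ g x⟫_ℂ * Complex.exp ((-2 * Real.pi * ⟪x, ξ⟫_ℝ : ℝ) * Complex.I)
      = ∫ t, ⟪f (t - ξ), g t⟫_ℂ :=
  calc _ = ∫ x, ⟪𝓕⁻ f x, 𝓕⁻ (fun v => g (v + ξ)) x⟫_ℂ := by
        simp_rw [fourierInv_comp_add_right, inner_smul_right, mul_comm]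
    _ = ∫ v, ⟪f v, g (v + ξ)⟫_ℂ :=
        integral_inner_fourierInv hf hf2 (hg.comp_add_right ξ)
          (hg2.comp_measurePreserving (measurePreserving_add_right volume ξ))
    _ = ∫ t, ⟪f (t - ξ), g t⟫_ℂ := by
        rw [← integral_sub_right_eq_self _ ξ]
        simp only [sub_add_cancel]

end FourierTranslation

section FiberFunctions

variable {m : ℕ}

/-- The function in `L²(ℝᵐ)` whose Fourier transform is the Schwartz function `φ`. -/
noncomputable def fourierInvL2 (φ : SchwartzMap (Rm m) ℂ) : L2 m :=
  (𝓕⁻ φ : SchwartzMap (Rm m) ℂ).toLp 2 volume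

theorem dense_range_fourierInvL2 : Dense (Set.range (fourierInvL2 (m := m))) := by
  refine (SchwartzMap.denseRange_toLpCLM (F := ℂ) (E := Rm m) (p := 2) (by norm_num)
    (μ := volume)).mono ?_
  rintro _ ⟨φ, rfl⟩
  exact ⟨𝓕 φ, by rw [fourierInvL2, FourierTransform.fourierInv_fourier_eq]; rfl⟩

theorem inner_fourierInvL2 (φ₁ φ₂ : SchwartzMap (Rm m) ℂ) :
    ⟪fourierInvL2 φ₂, fourierInvL2 φ₁⟫_ℂ = ∫ v, ⟪φ₂ v, φ₁ v⟫_ℂ := by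
  rw [fourierInvL2, fourierInvL2, ← SchwartzMap.inner_fourier_toL2_eq,
    FourierTransform.fourier_fourierInv_eq, FourierTransform.fourier_fourierInv_eq]
  exact SchwartzMap.inner_toL2_toL2_eq φ₂ φ₁ volume

/-- The complex conjugate of `ĝ(· - b)`, localised by the test function `φ`. -/
noncomputable def fiberFun (φ : SchwartzMap (Rm m) ℂ) (g : Rm m → ℂ) (b v : Rm m) : ℂ :=
  φ v * conj (𝓕 g (v - b))

theorem norm_fiberFun_le (φ : SchwartzMap (Rm m) ℂ) (g : Rm m → ℂ) (b v : Rm m) :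
    ‖fiberFun φ g b v‖ ≤ (∫ t, ‖g t‖) * ‖φ v‖ := by
  rw [fiberFun, norm_mul, RCLike.norm_conj, mul_comm]
  gcongr
  exact VectorFourier.norm_fourierIntegral_le_integral_norm _ _ _ _ _

section

variable {g : Rm m → ℂ} (hg : Integrable g)
include hg

theorem continuous_fiberFun (φ : SchwartzMap (Rm m) ℂ) (b : Rm m) :
    Continuous (fiberFun φ g b) :=
  φ.continuous.mul (Complex.continuous_conj.comp
    ((continuous_fourier_of_integrable hg).comp (continuous_sub_right b)))

theorem memLp_fiberFun (φ : SchwartzMap (Rm m) ℂ) (b : Rm m) (p : ℝ≥0∞) :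
    MemLp (fiberFun φ g b) p :=
  (φ.memLp p).of_le_mul (continuous_fiberFun hg φ b).aestronglyMeasurable
    (Eventually.of_forall (norm_fiberFun_le φ g b))

theorem integrable_fiberFun (φ : SchwartzMap (Rm m) ℂ) (b : Rm m) :
    Integrable (fiberFun φ g b) :=
  memLp_one_iff_integrable.1 (memLp_fiberFun hg φ b 1)

end

theorem modulate_eq_exp_smul (ω : Rm m) (f : Rm m → ℂ) :
    modulate ω f = fun t => Complex.exp ((2 * Real.pi * ⟪ω, t⟫_ℝ : ℝ) * Complex.I) • f t := by
  ext t
  rw [modulate, smul_eq_mul]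
  push_cast
  ring_nf

theorem inner_modL2_transL2_fourierInvL2 {g : L2 m} (hg : Integrable (g : Rm m → ℂ)) (b x : Rm m)
    (φ : SchwartzMap (Rm m) ℂ) :
    ⟪modL2 b g, transL2 (-x) (fourierInvL2 φ)⟫_ℂ = 𝓕⁻ (fiberFun φ g b) x := by
  let s : SchwartzMap (Rm m) ℂ := 𝓕⁻ φ
  have hs : 𝓕 (s : Rm m → ℂ) = φ := by
    rw [← SchwartzMap.fourier_coe, FourierTransform.fourier_fourierInv_eq]
  have hmod : Integrable (modulate b (g : Rm m → ℂ)) := by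
    rw [modulate_eq_exp_smul]
    exact hg.bdd_mul (c := 1) (by fun_prop)
      (Eventually.of_forall fun t => (Complex.norm_exp_ofReal_mul_I _).le)
  calc ⟪modL2 b g, transL2 (-x) (fourierInvL2 φ)⟫_ℂ = ∫ t, ⟪modulate b g t, s (t + x)⟫_ℂ := by
        have htrans := (measurePreserving_sub_right volume (-x)).quasiMeasurePreserving.ae_eq_comp
          (s.coeFn_toLp 2 volume)
        refine integral_congr_ae ?_
        filter_upwards [coeFn_transL2 (-x) (fourierInvL2 φ), htrans,
          (memLp_modulate b g).coeFn_toLp] with t ht hst hgt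
        rw [ht, modL2, hgt]
        simpa using! congrArg (⟪modulate b g t, ·⟫_ℂ) hst
    _ = ∫ v, ⟪𝓕 (modulate b (g : Rm m → ℂ)) v, 𝓕 (fun t => s (t + x)) v⟫_ℂ :=
        (integral_inner_fourier hmod (memLp_modulate b g) (s.integrable.comp_add_right x)
          ((s.memLp 2).comp_measurePreserving (measurePreserving_add_right volume x))).symm
    _ = 𝓕⁻ (fiberFun φ g b) x := by
        simp_rw [modulate_eq_exp_smul, fourier_exp_smul, fourier_comp_add_right, hs,
          Real.fourierInv_eq', inner_smul_right, RCLike.inner_apply, smul_eq_mul, fiberFun,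
          real_inner_comm x]

theorem exists_schwartz_eq_one (m : ℕ) (R : ℝ) :
    ∃ φ : SchwartzMap (Rm m) ℂ, ∀ v, ‖v‖ ≤ R → φ v = 1 := by
  let f : ContDiffBump (0 : Rm m) := ⟨|R| + 1, |R| + 2, by positivity, by linarith⟩
  refine ⟨realSchwartz f.contDiff f.hasCompactSupport, fun v hv => ?_⟩
  rw [realSchwartz_apply, f.one_of_mem_closedBall, Complex.ofReal_one]
  rw [mem_closedBall_zero_iff]
  exact hv.trans ((le_abs_self R).trans (by simp [f]))

end FiberFunctions

section Wiener

variable {m : ℕ}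

theorem integrable_of_memWiener {f : L2 m} (hf : MemWiener f) : Integrable (f : Rm m → ℂ) := by
  refine ⟨Lp.aestronglyMeasurable f, ?_⟩
  let c (k : Fin m → ℤ) : Set (Rm m) := cube (WithLp.toLp 2 fun i => (k i : ℝ)) 1
  have hcover : ⋃ k, c k = Set.univ := Set.eq_univ_of_forall fun y =>
    Set.mem_iUnion.2 ⟨fun i => ⌊y i⌋, fun i => ⟨Int.floor_le _, (Int.lt_floor_add_one _).le⟩⟩
  calc ∫⁻ t, ‖f t‖ₑ = ∫⁻ t in ⋃ k, c k, ‖f t‖ₑ := by rw [hcover, setLIntegral_univ]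
    _ ≤ ∑' k, ∫⁻ t in c k, ‖f t‖ₑ := lintegral_iUnion_le _ _
    _ ≤ ∑' k, eLpNorm ((c k).indicator (f : Rm m → ℂ)) 2 volume := by
        refine ENNReal.tsum_le_tsum fun k => ?_
        rw [← eLpNorm_one_eq_lintegral_enorm,
          eLpNorm_indicator_eq_eLpNorm_restrict (measurableSet_cube _ _)]
        refine (eLpNorm_le_eLpNorm_mul_rpow_measure_univ (q := 2) (by norm_num)
          (Lp.aestronglyMeasurable f).restrict).trans_eq ?_
        rw [Measure.restrict_apply_univ, volume_cube, ENNReal.ofReal_one, one_pow,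
          ENNReal.one_rpow, mul_one]
    _ < ∞ := hf

end Wiener

section Symbol

variable {m : ℕ} {J : Type*} {G H : J → L2 m} {b : J → Rm m} {Γ : Submodule ℤ (Rm m × ℝ)}

/-- The modulated family `M_{b j} G_j`. -/
noncomputable def modFamily (G : J → L2 m) (b : J → Rm m) (j : J) : L2 m := modL2 (b j) (G j)

/-- The series over the generators in the duality condition at the dual lattice points over `ξ`,
as a function of the frequency `t`. -/
noncomputable def symbolSum (G H : J → L2 m) (b : J → Rm m) (ξ t : Rm m) : ℂ :=
  ∑' j, conj (𝓕 (G j : Rm m → ℂ) (t - b j)) * 𝓕 (H j : Rm m → ℂ) (t - b j - ξ)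

theorem inner_fiberFun (φ₁ φ₂ : SchwartzMap (Rm m) ℂ) (g h : Rm m → ℂ) (β ξ t : Rm m) :
    ⟪fiberFun φ₂ h β (t - ξ), fiberFun φ₁ g β t⟫_ℂ
      = φ₁ t * conj (φ₂ (t - ξ)) * (conj (𝓕 g (t - β)) * 𝓕 h (t - β - ξ)) := by
  simp only [fiberFun, RCLike.inner_apply, map_mul, Complex.conj_conj, sub_right_comm t ξ]
  ring

theorem tsum_inner_fiberFun (φ₁ φ₂ : SchwartzMap (Rm m) ℂ) (ξ t : Rm m) :
    ∑' j, ⟪fiberFun φ₂ (H j) (b j) (t - ξ), fiberFun φ₁ (G j) (b j) t⟫_ℂ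
      = φ₁ t * conj (φ₂ (t - ξ)) * symbolSum G H b ξ t := by
  simp only [inner_fiberFun, tsum_mul_left, symbolSum]

theorem continuous_inner_fiberFun {g h : Rm m → ℂ} (hg : Integrable g) (hh : Integrable h)
    (φ₁ φ₂ : SchwartzMap (Rm m) ℂ) (β ξ : Rm m) :
    Continuous fun t => ⟪fiberFun φ₂ h β (t - ξ), fiberFun φ₁ g β t⟫_ℂ :=
  ((continuous_fiberFun hh φ₂ β).comp (continuous_sub_right ξ)).inner
    (continuous_fiberFun hg φ₁ β)

theorem integral_mixed_mul_exp {g h : L2 m} (hg : Integrable (g : Rm m → ℂ))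
    (hh : Integrable (h : Rm m → ℂ)) (β : Rm m) (φ₁ φ₂ : SchwartzMap (Rm m) ℂ) (ξ : Rm m) :
    ∫ x, ⟪transL2 (-x) (fourierInvL2 φ₂), modL2 β h⟫_ℂ
        * ⟪modL2 β g, transL2 (-x) (fourierInvL2 φ₁)⟫_ℂ
        * Complex.exp ((-2 * Real.pi * ⟪x, ξ⟫_ℝ : ℝ) * Complex.I)
      = ∫ t, ⟪fiberFun φ₂ h β (t - ξ), fiberFun φ₁ g β t⟫_ℂ := by
  rw [← integral_inner_fourierInv_mul_exp (integrable_fiberFun hh φ₂ β) (memLp_fiberFun hh φ₂ β 2)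
    (integrable_fiberFun hg φ₁ β) (memLp_fiberFun hg φ₁ β 2)]
  simp_rw [← inner_conj_symm _ (modL2 β h), inner_modL2_transL2_fourierInvL2 hh,
    inner_modL2_transL2_fourierInvL2 hg, RCLike.inner_apply, mul_comm (conj _)]

variable [Countable J]

theorem tsum_lintegral_fiberFun (hG : ∀ j, Integrable (G j : Rm m → ℂ))
    (φ : SchwartzMap (Rm m) ℂ) :
    ∑' j, ∫⁻ v, ‖fiberFun φ (G j) (b j) v‖ₑ ^ 2
      = ∫⁻ x, energy (modFamily G b) (transL2 (-x) (fourierInvL2 φ)) := by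
  simp_rw [energy]
  rw [lintegral_tsum fun _ => ((continuous_const.inner
    (continuous_transL2_neg _)).enorm.measurable.pow_const 2).aemeasurable]
  refine tsum_congr fun j => ?_
  rw [← lintegral_enorm_sq_fourierInv (integrable_fiberFun (hG j) φ _)
    (memLp_fiberFun (hG j) φ _ 2)]
  simp_rw [modFamily, inner_modL2_transL2_fourierInvL2 (hG j)]

variable [DiscreteTopology Γ] [IsZLattice ℝ Γ]

theorem ae_tsum_enorm_sq_fiber_ne_top (hG : ∀ j, Integrable (G j : Rm m → ℂ))
    (hu : IsLatticeBessel Γ (modFamily G b)) :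
    ∀ᵐ t : Rm m, ∑' j, ‖𝓕 (G j : Rm m → ℂ) (t - b j)‖ₑ ^ 2 ≠ ∞ := by
  have hball (n : ℕ) :
      ∀ᵐ t : Rm m, ‖t‖ ≤ n → ∑' j, ‖𝓕 (G j : Rm m → ℂ) (t - b j)‖ₑ ^ 2 ≠ ∞ := by
    obtain ⟨φ, hφ⟩ := exists_schwartz_eq_one m n
    have hmeas (j : J) : Measurable fun v => ‖fiberFun φ (G j) (b j) v‖ₑ ^ 2 :=
      (continuous_fiberFun (hG j) φ (b j)).enorm.measurable.pow_const 2
    have hfin : ∫⁻ v, ∑' j, ‖fiberFun φ (G j) (b j) v‖ₑ ^ 2 ≠ ∞ := by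
      rw [lintegral_tsum fun j => (hmeas j).aemeasurable, tsum_lintegral_fiberFun hG]
      exact hu.lintegral_energy_ne_top _
    filter_upwards [ae_lt_top (Measurable.tsum hmeas) hfin] with t ht hn
    simpa only [fiberFun, hφ t hn, one_mul, RCLike.enorm_conj] using ht.ne
  filter_upwards [ae_all_iff.2 hball] with t ht
  obtain ⟨n, hn⟩ := exists_nat_ge ‖t‖
  exact ht n hn

variable (hG : ∀ j, Integrable (G j : Rm m → ℂ)) (hH : ∀ j, Integrable (H j : Rm m → ℂ))
  (hu : IsLatticeBessel Γ (modFamily G b)) (hv : IsLatticeBessel Γ (modFamily H b))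
include hG hH hu hv

theorem ae_summable_symbol (ξ : Rm m) :
    ∀ᵐ t : Rm m, Summable fun j =>
      conj (𝓕 (G j : Rm m → ℂ) (t - b j)) * 𝓕 (H j : Rm m → ℂ) (t - b j - ξ) := by
  have hHξ := (measurePreserving_sub_right volume ξ).quasiMeasurePreserving.ae
    (ae_tsum_enorm_sq_fiber_ne_top hH hv)
  filter_upwards [ae_tsum_enorm_sq_fiber_ne_top hG hu, hHξ] with t hGt hHt
  refine Summable.of_norm (tsum_enorm_ne_top_iff_summable_norm.1 ?_)
  refine ne_top_of_le_ne_top (ENNReal.add_ne_top.2 ⟨hGt, hHt⟩) ?_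
  rw [← ENNReal.tsum_add]
  refine ENNReal.tsum_le_tsum fun j => ?_
  rw [enorm_mul, RCLike.enorm_conj, sub_right_comm]
  exact mul_le_sq_add_sq _ _

variable (φ₁ φ₂ : SchwartzMap (Rm m) ℂ) (ξ : Rm m)

theorem tsum_lintegral_inner_fiberFun_ne_top :
    ∑' j, ∫⁻ t, ‖⟪fiberFun φ₂ (H j) (b j) (t - ξ), fiberFun φ₁ (G j) (b j) t⟫_ℂ‖ₑ ≠ ∞ := by
  have hfin := ENNReal.add_ne_top.2 ⟨hu.lintegral_energy_ne_top (fourierInvL2 φ₁),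
    hv.lintegral_energy_ne_top (fourierInvL2 φ₂)⟩
  rw [← tsum_lintegral_fiberFun hG, ← tsum_lintegral_fiberFun hH, ← ENNReal.tsum_add] at hfin
  refine ne_top_of_le_ne_top hfin (ENNReal.tsum_le_tsum fun j => ?_)
  rw [← lintegral_sub_right_eq_self (fun v => ‖fiberFun φ₂ (H j) (b j) v‖ₑ ^ 2) ξ,
    ← lintegral_add_left ((continuous_fiberFun (hG j) φ₁ (b j)).enorm.measurable.pow_const 2)]
  refine lintegral_mono fun t => ?_
  rw [RCLike.inner_apply, enorm_mul, RCLike.enorm_conj]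
  exact mul_le_sq_add_sq _ _

theorem integrable_mul_symbolSum :
    Integrable fun t => φ₁ t * conj (φ₂ (t - ξ)) * symbolSum G H b ξ t := by
  simp_rw [← tsum_inner_fiberFun]
  exact integrable_tsum
    (fun j => (continuous_inner_fiberFun (hG j) (hH j) φ₁ φ₂ (b j) ξ).aestronglyMeasurable)
    (tsum_lintegral_inner_fiberFun_ne_top hG hH hu hv φ₁ φ₂ ξ)

theorem integral_mixedSum_mul_exp :
    ∫ x, mixedSum (modFamily G b) (modFamily H b) (fourierInvL2 φ₁) (fourierInvL2 φ₂) x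
        * Complex.exp ((-2 * Real.pi * ⟪x, ξ⟫_ℝ : ℝ) * Complex.I)
      = ∫ t, φ₁ t * conj (φ₂ (t - ξ)) * symbolSum G H b ξ t := by
  have hfin := tsum_lintegral_mixed_ne_top hu hv (fourierInvL2 φ₁) (fourierInvL2 φ₂)
  simp_rw [mixedSum, ← tsum_mul_right]
  rw [integral_tsum]
  · simp_rw [modFamily, integral_mixed_mul_exp (hG _) (hH _)]
    rw [← integral_tsum
      (fun j => (continuous_inner_fiberFun (hG j) (hH j) φ₁ φ₂ (b j) ξ).aestronglyMeasurable)
      (tsum_lintegral_inner_fiberFun_ne_top hG hH hu hv φ₁ φ₂ ξ)]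
    simp_rw [tsum_inner_fiberFun]
  · exact fun j => ((continuous_mixed _ _ _ _).mul (by fun_prop)).aestronglyMeasurable
  · simpa only [enorm_mul _ (Complex.exp _), ← ofReal_norm (Complex.exp _),
      Complex.norm_exp_ofReal_mul_I, ENNReal.ofReal_one, mul_one] using hfin

theorem locallyIntegrable_symbolSum : LocallyIntegrable (symbolSum G H b ξ) := by
  intro x
  refine ⟨Metric.closedBall x 1, Metric.closedBall_mem_nhds x one_pos, ?_⟩
  obtain ⟨φ₁, hφ₁⟩ := exists_schwartz_eq_one m (‖x‖ + 1)
  obtain ⟨φ₂, hφ₂⟩ := exists_schwartz_eq_one m (‖x‖ + 1 + ‖ξ‖)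
  refine (integrable_mul_symbolSum hG hH hu hv φ₁ φ₂ ξ).integrableOn.congr_fun (fun t ht => ?_)
    measurableSet_closedBall
  have ht : ‖t‖ ≤ ‖x‖ + 1 := norm_le_of_mem_closedBall ht
  have htξ : ‖t - ξ‖ ≤ ‖x‖ + 1 + ‖ξ‖ := (norm_sub_le _ _).trans (by gcongr)
  simp only [hφ₁ t ht, hφ₂ _ htξ, map_one, one_mul]

end Symbol

section DualLattice

variable {m : ℕ} {Γ : Submodule ℤ (Rm m × ℝ)}

/-- The linear functional `z ↦ z · η`, through which `Γ*` acts as the dual of `Γ`. -/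
noncomputable def dotFunctional (η : Rm m × ℝ) : (Rm m × ℝ) →L[ℝ] ℝ :=
  (innerSL ℝ η.1).comp (ContinuousLinearMap.fst ℝ (Rm m) ℝ)
    + η.2 • ContinuousLinearMap.snd ℝ (Rm m) ℝ

theorem dotFunctional_apply (η z : Rm m × ℝ) :
    dotFunctional η z = ⟪z.1, η.1⟫_ℝ + z.2 * η.2 := by
  simp [dotFunctional, real_inner_comm, mul_comm]

theorem isIntegralOn_dotFunctional {η : Rm m × ℝ} :
    IsIntegralOn Γ (dotFunctional η) ↔ η ∈ dualLattice Γ := by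
  simp only [IsIntegralOn, dotFunctional_apply, dualLattice, Set.mem_ofPred_eq]

theorem dotFunctional_eq_zero {η : Rm m × ℝ} : dotFunctional η = 0 ↔ η = 0 := by
  constructor
  · intro h
    have hfst := congrArg (fun l : (Rm m × ℝ) →L[ℝ] ℝ => l (η.1, 0)) h
    have hsnd := congrArg (fun l : (Rm m × ℝ) →L[ℝ] ℝ => l (0, 1)) h
    simp only [dotFunctional_apply] at hfst hsnd
    exact Prod.ext (by simpa using hfst) (by simpa using hsnd)
  · rintro rfl
    ext <;> simp [dotFunctional_apply]

theorem exists_dotFunctional_eq (l : (Rm m × ℝ) →L[ℝ] ℝ) : ∃ η, dotFunctional η = l := by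
  refine ⟨((InnerProductSpace.toDual ℝ (Rm m)).symm (l.comp (ContinuousLinearMap.inl ℝ (Rm m) ℝ)),
    l (0, 1)), ContinuousLinearMap.ext fun z => ?_⟩
  have hz : z = (z.1, 0) + z.2 • ((0, 1) : Rm m × ℝ) := by ext1 <;> simp
  rw [dotFunctional_apply, real_inner_comm, InnerProductSpace.toDual_symm_apply]
  conv_rhs => rw [hz, map_add, map_smul]
  simp

theorem ae_periodization_eq_const_iff_dualLattice [DiscreteTopology Γ] [IsZLattice ℝ Γ]
    {F : Rm m × ℝ → ℂ} (hF : Integrable F) (κ : ℂ) :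
    (∀ᵐ z, periodization Γ F z = κ) ↔ ∀ η ∈ dualLattice Γ,
      ∫ z, F z * linChar (dotFunctional η) z = delta η * (κ * ZLattice.covolume Γ) := by
  have hzero : dotFunctional (0 : Rm m × ℝ) = 0 := dotFunctional_eq_zero.2 rfl
  rw [ae_periodization_eq_const_iff hF]
  constructor
  · rintro ⟨hint, hvanish⟩ η hη
    by_cases h : η = 0
    · simpa [h, hzero, delta] using hint
    · rw [hvanish _ (isIntegralOn_dotFunctional.2 hη) (mt dotFunctional_eq_zero.1 h), delta,
        if_neg h, zero_mul]
  · intro h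
    refine ⟨by simpa [hzero, delta] using h 0 fun γ _ => ⟨0, by simp⟩, fun l hl hl0 => ?_⟩
    obtain ⟨η, rfl⟩ := exists_dotFunctional_eq l
    rw [h η (isIntegralOn_dotFunctional.1 hl), delta, if_neg (mt dotFunctional_eq_zero.2 hl0),
      zero_mul]

theorem linChar_dotFunctional (η z : Rm m × ℝ) :
    linChar (dotFunctional η) z
      = Complex.exp ((-2 * Real.pi * ⟪z.1, η.1⟫_ℝ : ℝ) * Complex.I)
        * Complex.exp ((-2 * Real.pi * (z.2 * η.2) : ℝ) * Complex.I) := by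
  rw [linChar, dotFunctional_apply, ← Complex.exp_add]
  congr 1
  push_cast
  ring

theorem integral_windowTensor_mul_linChar {J : Type*} (u v : J → L2 m) (W : Set ℝ) (f₁ f₂ : L2 m)
    (η : Rm m × ℝ) :
    ∫ z, windowTensor u v W f₁ f₂ z * linChar (dotFunctional η) z
      = (∫ x, mixedSum u v f₁ f₂ x
          * Complex.exp ((-2 * Real.pi * ⟪x, η.1⟫_ℝ : ℝ) * Complex.I))
        * 𝓕 (W.indicator (1 : ℝ → ℂ)) η.2 := by
  rw [Real.fourier_real_eq_integral_exp_smul, Measure.volume_eq_prod, ← integral_prod_mul]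
  refine integral_congr_ae (Eventually.of_forall fun z => ?_)
  simp only [windowTensor, linChar_dotFunctional, smul_eq_mul, mul_assoc]
  ring

end DualLattice

section Characterization

variable {m : ℕ} {J : Type*} {Γ : Submodule ℤ (Rm m × ℝ)}

theorem ae_eq_const_of_forall_integral_schwartz {f : Rm m → ℂ} (hf : LocallyIntegrable f)
    (ξ : Rm m) {d : ℂ} (h : ∀ φ₁ φ₂ : SchwartzMap (Rm m) ℂ,
      ∫ t, φ₁ t * conj (φ₂ (t - ξ)) * f t = ∫ t, φ₁ t * conj (φ₂ (t - ξ)) * d) :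
    ∀ᵐ t : Rm m, f t = d := by
  refine ae_eq_of_integral_contDiff_smul_eq hf (locallyIntegrable_const d) fun g hg hgs => ?_
  obtain ⟨R, hR⟩ := hgs.isCompact.isBounded.exists_norm_le
  obtain ⟨φ₂, hφ₂⟩ := exists_schwartz_eq_one m (R + ‖ξ‖)
  have hg_eq (t : Rm m) : realSchwartz hg hgs t * conj (φ₂ (t - ξ)) = g t := by
    rw [realSchwartz_apply]
    by_cases ht : t ∈ tsupport g
    · rw [hφ₂ _ ((norm_sub_le _ _).trans (by linarith [hR t ht])), map_one, mul_one]
    · rw [image_eq_zero_of_notMem_tsupport ht, Complex.ofReal_zero, zero_mul]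
  simpa only [hg_eq, Complex.real_smul] using h (realSchwartz hg hgs) φ₂

theorem forall_integral_symbolSum_iff [Countable J] [DiscreteTopology Γ] [IsZLattice ℝ Γ]
    {G H : J → L2 m} {b : J → Rm m} (hG : ∀ j, Integrable (G j : Rm m → ℂ))
    (hH : ∀ j, Integrable (H j : Rm m → ℂ)) (hu : IsLatticeBessel Γ (modFamily G b))
    (hv : IsLatticeBessel Γ (modFamily H b)) (c : ℂ) (η : Rm m × ℝ) :
    (∀ φ₁ φ₂ : SchwartzMap (Rm m) ℂ,
      c * ∫ t, φ₁ t * conj (φ₂ (t - η.1)) * symbolSum G H b η.1 t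
        = delta η * ∫ t, ⟪φ₂ t, φ₁ t⟫_ℂ) ↔
      ∀ᵐ t : Rm m, c * symbolSum G H b η.1 t = delta η := by
  have hdelta (φ₁ φ₂ : SchwartzMap (Rm m) ℂ) :
      delta η * ∫ t, ⟪φ₂ t, φ₁ t⟫_ℂ = ∫ t, φ₁ t * conj (φ₂ (t - η.1)) * delta η := by
    by_cases h : η = 0 <;> simp [h, delta]
  simp_rw [hdelta, ← integral_const_mul, mul_left_comm c]
  refine ⟨fun h => ?_, fun h φ₁ φ₂ => integral_congr_ae ?_⟩
  · exact ae_eq_const_of_forall_integral_schwartz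
      ((locallyIntegrable_symbolSum hG hH hu hv η.1).smul c) η.1 h
  · filter_upwards [h] with t ht
    rw [ht]

variable [Countable J] [DiscreteTopology Γ] [IsZLattice ℝ Γ] {W : Set ℝ}
  (hinj : Set.InjOn Prod.fst (Γ : Set (Rm m × ℝ)))
  (hdense : Dense (Prod.snd '' (Γ : Set (Rm m × ℝ)))) (hW : Bornology.IsBounded W)
  (hW' : volume (frontier W) = 0) (hgen : IsGeneric Γ W)
include hinj hdense hW hW' hgen

theorem isDualSystem_modelSystem_iff {u v : J → L2 m} (hu : IsLatticeBessel Γ u)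
    (hv : IsLatticeBessel Γ v) :
    IsDualSystem (modelSystem v (modelSet Γ W)) (modelSystem u (modelSet Γ W)) ↔
      ∀ φ₁ φ₂ : SchwartzMap (Rm m) ℂ, ∀ η ∈ dualLattice Γ,
        ∫ z, windowTensor u v W (fourierInvL2 φ₁) (fourierInvL2 φ₂) z
            * linChar (dotFunctional η) z
          = delta η * (⟪fourierInvL2 φ₂, fourierInvL2 φ₁⟫_ℂ * ZLattice.covolume Γ) := by
  have huB := hu.isBessel_modelSystem hinj hW
  have hvB := hv.isBessel_modelSystem hinj hW
  have hfourier (f₁ f₂ : L2 m) := (forall_periodization_windowTensor_eq_iff hinj hdense hW hW' hgen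
    hu hv f₁ f₂ ⟪f₂, f₁⟫_ℂ).trans (ae_periodization_eq_const_iff_dualLattice
      (integrable_windowTensor hu hv hW (nullMeasurableSet_of_null_frontier hW') f₁ f₂) _)
  simp_rw [periodization_windowTensor hinj huB hvB] at hfourier
  constructor
  · intro h φ₁ φ₂
    refine (hfourier _ _).1 fun x => ?_
    rw [(isDualSystem_iff huB hvB dense_univ).1 h _ trivial _ trivial, LinearIsometry.inner_map_map]
  · intro h
    refine (isDualSystem_iff huB hvB dense_range_fourierInvL2).2 ?_
    rintro _ ⟨φ₁, rfl⟩ _ ⟨φ₂, rfl⟩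
    simpa only [neg_zero, transL2_zero] using (hfourier _ _).2 (h φ₁ φ₂) 0

theorem isDualSystem_modFamily_iff {G H : J → L2 m} {b : J → Rm m}
    (hG : ∀ j, Integrable (G j : Rm m → ℂ)) (hH : ∀ j, Integrable (H j : Rm m → ℂ))
    (hu : IsLatticeBessel Γ (modFamily G b)) (hv : IsLatticeBessel Γ (modFamily H b)) :
    IsDualSystem (modelSystem (modFamily H b) (modelSet Γ W))
        (modelSystem (modFamily G b) (modelSet Γ W)) ↔
      ∀ η ∈ dualLattice Γ, ∀ᵐ t : Rm m,
        𝓕 (W.indicator (1 : ℝ → ℂ)) η.2 / ZLattice.covolume Γ * symbolSum G H b η.1 t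
          = delta η := by
  have hvol : (ZLattice.covolume Γ : ℂ) ≠ 0 :=
    Complex.ofReal_ne_zero.2 (ZLattice.covolume_ne_zero Γ volume)
  have hnormalize (S c d I : ℂ) : S * c = d * (I * ZLattice.covolume Γ) ↔
      c / ZLattice.covolume Γ * S = d * I := by
    rw [← mul_assoc d, ← div_eq_iff hvol, div_mul_eq_mul_div, mul_comm]
  rw [isDualSystem_modelSystem_iff hinj hdense hW hW' hgen hu hv]
  simp_rw [integral_windowTensor_mul_linChar, integral_mixedSum_mul_exp hG hH hu hv,
    inner_fourierInvL2, hnormalize, ← forall_integral_symbolSum_iff hG hH hu hv]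
  exact ⟨fun h η hη φ₁ φ₂ => h φ₁ φ₂ η hη, fun h φ₁ φ₂ η hη => h η hη φ₁ φ₂⟩

end Characterization

section Phase

variable {m : ℕ} {Γ : Submodule ℤ (Rm m × ℝ)} [DiscreteTopology Γ] [IsZLattice ℝ Γ]

theorem mul_eq_delta_iff {η : Rm m × ℝ} {w x : ℂ} (hw : w ≠ 0) (hw' : η = 0 → w = 1) :
    w * x = delta η ↔ x = delta η := by
  by_cases h : η = 0
  · simp [hw' h]
  · simp [delta, h, hw]

/-- The phase `θ` comes from the centre of the window; it vanishes when `Ω` is symmetric. -/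
theorem exists_fourier_indicator_div_covolume_eq
    (hinj : Set.InjOn Prod.fst (Γ : Set (Rm m × ℝ)))
    (hdense : Dense (Prod.snd '' (Γ : Set (Rm m × ℝ)))) {Ω : Set ℝ} (hΩ : IsSimpleWindow Ω)
    {ε : ℝ} (hε : 0 < ε) (hε' : ε < 1) :
    ∃ θ : ℝ, ∀ s : ℝ, 𝓕 (Ω.indicator (1 : ℝ → ℂ)) s / ZLattice.covolume Γ
      = Complex.exp ((θ * s : ℝ) * Complex.I) * (density (modelSet Γ Ω) * Phi ε Ω (-s)) := by
  obtain ⟨a, b, hab, rfl⟩ := hΩ.exists_eq_Icc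
  have hlength : volume.real (Set.Icc a b) = b - a := Real.volume_real_Icc_of_le hab.le
  refine ⟨-Real.pi * (a + b), fun s => ?_⟩
  rw [fourier_indicator_Icc hab.le, density_modelSet hdense hinj hab,
    Phi_eq_sinc hε hε' (by rw [hlength]; linarith), hlength, neg_mul s, mul_neg, Real.sinc_neg,
    mul_assoc (-Real.pi)]
  push_cast
  ring

end Phase

theorem IsUniformlyDiscrete.countable {m : ℕ} {Δ : Set (Rm m)} (hΔ : IsUniformlyDiscrete Δ) :
    Δ.Countable := by
  obtain ⟨r, hr, hdist⟩ := hΔ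
  have : DiscreteTopology Δ := DiscreteTopology.of_forall_le_dist hr fun x y hxy =>
    hdist x x.2 y y.2 (Subtype.coe_ne_coe.2 hxy)
  exact Set.countable_coe_iff.1 (TopologicalSpace.separableSpace_iff_countable.1 inferInstance)

theorem corollary5p3_general {m L : ℕ} (Γ : Submodule ℤ (Rm m × ℝ)) [DiscreteTopology Γ]
    [IsZLattice ℝ Γ] (hinj : Set.InjOn Prod.fst (Γ : Set (Rm m × ℝ)))
    (hdense : Dense (Prod.snd '' (Γ : Set (Rm m × ℝ)))) (Ω : Set ℝ) (hΩ : IsSimpleWindow Ω)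
    (hgen : IsGeneric Γ Ω) (ε : ℝ) (hε : 0 < ε) (hε' : ε < 1) (Δ : Set (Rm m)) (hΔ : Δ.Countable)
    (g h : Fin L → L2 m) (hg : ∀ l, Integrable (g l : Rm m → ℂ))
    (hh : ∀ l, Integrable (h l : Rm m → ℂ)) (hgB : IsBessel (gaborSystem g (modelSet Γ Ω) Δ))
    (hhB : IsBessel (gaborSystem h (modelSet Γ Ω) Δ)) :
    HasDensity (modelSet Γ Ω) (density (modelSet Γ Ω)) ∧
    TendstoUniformly (psiHat ε Ω) (Psi ε Ω) atTop ∧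
    (∀ t : ℝ, Integrable (fun x : ℝ => Psi ε Ω x * Psi ε Ω (t - x))) ∧
    (∀ η ∈ dualLattice Γ, ∀ l, ∀ᵐ t : Rm m, Summable (fun β : Δ =>
      conj (𝓕 (g l : Rm m → ℂ) (t - β)) * 𝓕 (h l : Rm m → ℂ) (t - β - η.1))) ∧
    (IsDualSystem (gaborSystem h (modelSet Γ Ω) Δ) (gaborSystem g (modelSet Γ Ω) Δ) ↔
      ∀ η ∈ dualLattice Γ, ∀ᵐ t : Rm m,
        (density (modelSet Γ Ω) : ℂ) * (Phi ε Ω (-η.2) : ℂ) *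
          ∑ l, ∑' β : Δ,
            conj (𝓕 (g l : Rm m → ℂ) (t - β)) * 𝓕 (h l : Rm m → ℂ) (t - β - η.1)
          = delta η) := by
  have := hΔ.to_subtype
  let G (j : Fin L × Δ) := g j.1
  let H (j : Fin L × Δ) := h j.1
  let b (j : Fin L × Δ) : Rm m := j.2
  have hG (j) : Integrable (G j : Rm m → ℂ) := hg j.1
  have hH (j) : Integrable (H j : Rm m → ℂ) := hh j.1
  have hbdd := hΩ.isCompact.isBounded
  have hbessel (u : Fin L × Δ → L2 m) :=
    isBessel_modelSystem_iff hinj hdense hbdd hΩ.nonempty_interior (u := u)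
  have hu : IsLatticeBessel Γ (modFamily G b) := (hbessel _).1 hgB
  have hv : IsLatticeBessel Γ (modFamily H b) := (hbessel _).1 hhB
  have hsum := ae_summable_symbol hG hH hu hv
  refine ⟨hasDensity_density_modelSet hdense hinj hΩ, tendstoUniformly_psiHat hε hε' Ω,
    integrable_Psi_mul_Psi hε hε' hΩ.volume_pos,
    fun η _ l => (hsum η.1).mono fun t ht => ht.prod_factor l, ?_⟩
  obtain ⟨θ, hθ⟩ := exists_fourier_indicator_div_covolume_eq hinj hdense hΩ hε hε'
  refine (isDualSystem_modFamily_iff hinj hdense hbdd (hΩ.ordConnected.convex.addHaar_frontier _)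
    hgen hG hH hu hv).trans (forall₂_congr fun η _ => eventually_congr ?_)
  filter_upwards [hsum η.1] with t ht
  rw [hθ, mul_assoc, mul_eq_delta_iff (Complex.exp_ne_zero _) (by simp +contextual), symbolSum,
    ht.tsum_prod, tsum_fintype]

end ModelSetGabor

theorem corollary5p3 {m L : ℕ}
    -- the lattice and its projections
    (Γ : Submodule ℤ (Rm m × ℝ)) [DiscreteTopology Γ] [IsZLattice ℝ Γ]
    (hΓ : ProjectionsInjectiveDense Γ)
    -- the window, symmetric around the origin; the simple model set is generic
    (Ω : Set ℝ) (hΩ : IsSimpleWindow Ω) (hsymm : ∀ x ∈ Ω, -x ∈ Ω) (hgen : IsGeneric Γ Ω)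
    -- the parameter in the construction of `Φ`
    (ε : ℝ) (hε : 0 < ε) (hε' : ε < 1)
    (Δ : Set (Rm m)) (hΔ : IsRelativelyDense Δ) (hΔ' : IsUniformlyDiscrete Δ)
    (g h : Fin L → L2 m) (hg : ∀ l, MemWiener (g l)) (hh : ∀ l, MemWiener (h l))
    (hgB : IsBessel (gaborSystem g (modelSet Γ Ω) Δ))
    (hhB : IsBessel (gaborSystem h (modelSet Γ Ω) Δ)) :
    -- the limits that define the density and `Ψ` exist, the convolution `Ψ * Ψ` and the series
    -- below converge absolutely
    HasDensity (modelSet Γ Ω) (density (modelSet Γ Ω)) ∧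
    TendstoUniformly (psiHat ε Ω) (Psi ε Ω) atTop ∧
    (∀ t : ℝ, Integrable (fun x : ℝ => Psi ε Ω x * Psi ε Ω (t - x))) ∧
    (∀ η ∈ dualLattice Γ, ∀ l, ∀ᵐ t : Rm m, Summable (fun β : Δ =>
      conj (𝓕 (g l : Rm m → ℂ) (t - β)) * 𝓕 (h l : Rm m → ℂ) (t - β - η.1))) ∧
    -- the characterization
    (IsDualSystem (gaborSystem h (modelSet Γ Ω) Δ) (gaborSystem g (modelSet Γ Ω) Δ) ↔
      ∀ η ∈ dualLattice Γ, ∀ᵐ t : Rm m,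
        (density (modelSet Γ Ω) : ℂ) * (Phi ε Ω (-η.2) : ℂ) *
          ∑ l, ∑' β : Δ,
            conj (𝓕 (g l : Rm m → ℂ) (t - β)) * 𝓕 (h l : Rm m → ℂ) (t - β - η.1)
          = delta η) :=
  corollary5p3_general Γ hΓ.injOn_fst hΓ.dense_snd Ω hΩ hgen ε hε hε' Δ hΔ'.countable g h
    (fun l => integrable_of_memWiener (hg l)) (fun l => integrable_of_memWiener (hh l)) hgB hhB
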